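/- Let $d=2n+1$ ($n\ge 0$) and $M\ge 0$, and let $H$ be a tight-binding Hamiltonian on $\ell^2(\mathbb Z^d,\mathbb C^M)$, $(H\varphi)_\alpha(x)=\sum_{y}\sum_\beta t^{\alpha,\beta}_{x,y}\varphi_\beta(y)$, with hopping amplitudes that are Hermitian ($t^{\beta,\alpha}_{y,x}=\overline{t^{\alpha,\beta}_{x,y}}$), of finite range and uniformly bounded. Call a real number $E$ an admissible Fermi level for $H$ if there are constants $\mathcal C_0,\xi_0>0$ such that $$\sup_{\varepsilon>0}\bigl\|\chi_{\{x\}}(E+i\varepsilon-H)^{-1}\chi_{\{y\}}\bigr\|\le \mathcal C_0\,e^{-|x-y|/\xi_0}\qquad\text{for all }x,y\in\mathbb Z^d .$$ Let $P_{\rm F}=P_{\rm F}(H)$ be the spectral projection of $H$ onto energies below $E$. Let $\gamma^{(1)},\dots,\gamma^{(2n+1)}$ be the standard gamma matrices on $\mathbb C^{2^n}$, that is, for $m=1,\dots,n$, $\gamma^{(2m-1)}=\sigma_0^{\otimes(m-1)}\otimes\sigma_1\otimes\sigma_3^{\otimes(n-m)}$, $\gamma^{(2m)}=\sigma_0^{\otimes(m-1)}\otimes\sigma_2\otimes\sigma_3^{\otimes(n-m)}$,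 and $\gamma^{(2n+1)}=\sigma_3^{\otimes n}$, where $\sigma_0=1$ and $\sigma_1,\sigma_2,\sigma_3$ are the Pauli matrices. For $a\in\mathbb R^d\setminus\mathbb Z^d$ let $D_a(x)=|x-a|^{-1}(x-a)\cdot\gamma$ be the Dirac operator on $\ell^2(\mathbb Z^d,\mathbb C^M)\otimes\mathbb C^{2^n}$, and put $A=P_{\rm F}-D_aP_{\rm F}D_a$, where $P_{\rm F}$ stands for $P_{\rm F}\otimes 1$. For a unitary $M\times M$ matrix $U$ let $\Theta\varphi=U\overline\varphi$ (acting at every site). The symmetry classes without chiral symmetry are: A (no condition); AI and AII ($\Theta H=H\Theta$, with $\Theta^2=+1$ and $\Theta^2=-1$ respectively); D and C ($\Theta H=-H\Theta$ and $E=0$, with $\Theta^2=+1$ and $\Theta^2=-1$ respectively). Suppose that $H$ has the symmetry of one of these classes and that $E$ is an admissible Fermi level for $H$. Then: (1) For every class, $\ker(A-1)$ and $\ker(A+1)$ are finite-dimensional, and the integer-valued index vanishes: $$\dim\ker(A-1)-\dim\ker(A+1)=0 .$$ (2) At the entries marked $\mathbb Z_2$ in the periodic table, namely AII with $d\equiv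 3$, AI with $d\equiv 7$, D with $d\equiv 1$ and C with $d\equiv 5$ modulo $8$, the $\mathbb Z_2$ index $${\rm Ind}_2(D_a,P_{\rm F}):=\dim\ker\bigl[(P_{\rm F}-D_aP_{\rm F}D_a)-1\bigr]\ \text{ modulo } 2$$ is continuous in the norm of symmetry-preserving perturbations: there is $\delta>0$ such that every tight-binding Hamiltonian $H'$ with the same symmetry (same $\Theta$, same class) and $\|H'-H\|<\delta$ has finite-dimensional kernel and ${\rm Ind}_2(D_a,P_{\rm F}(H'))={\rm Ind}_2(D_a,P_{\rm F}(H))$. Moreover ${\rm Ind}_2$ is constant along every norm-continuous path $H_s$, $s\in[0,1]$, $H_0=H$, of tight-binding Hamiltonians with the same symmetry for all of which $E$ is an admissible Fermi level. (3) At the empty entries AII with $d\equiv 1,7$, AI with $d\equiv 3,5$, C with $d\equiv 1,3$ and D with $d\equiv 5,7$ modulo $8$, $\dim\ker(A-1)$ is even, so that the $\mathbb Z_2$ index vanishes. -/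

import Mathlib

open scoped InnerProductSpace ComplexConjugate

noncomputable section

namespace OddTI

/-! ### The one-particle Hilbert space -/

/-- The sites of the hypercubic lattice `ℤ^d`. -/
abbrev Site (d : ℕ) : Type := Fin d → ℤ

/-- A lattice site regarded as a point of Euclidean space `ℝ^d`. -/
def latticePoint {d : ℕ} (x : Site d) : EuclideanSpace ℝ (Fin d) :=
  WithLp.toLp 2 (fun j => (x j : ℝ))

/-- The Hilbert space `ℓ²(ℤ^d, ℂ^M)`. -/
abbrev Wave (d M : ℕ) : Type := lp (fun _ : Site d => EuclideanSpace ℂ (Fin M)) 2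

/-- Bounded operators on `ℓ²(ℤ^d, ℂ^M)`. -/
abbrev Op (d M : ℕ) : Type := Wave d M →L[ℂ] Wave d M

/-- Multiplication by a real function of the site which is bounded by `1`. -/
def mulOp {d : ℕ} (M : ℕ) (f : Site d → ℝ) (hf : ∀ x, |f x| ≤ 1) : Op d M :=
  lp.mapCLM (E := fun _ : Site d => EuclideanSpace ℂ (Fin M))
    (F := fun _ : Site d => EuclideanSpace ℂ (Fin M)) 2
    (fun x => (f x : ℂ) • ContinuousLinearMap.id ℂ (EuclideanSpace ℂ (Fin M)))
    (K := 1) zero_le_one (fun x => by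
      refine ContinuousLinearMap.opNorm_le_bound _ zero_le_one (fun v => ?_)
      simp only [smul_apply, ContinuousLinearMap.id_apply, norm_smul,
        Complex.norm_real, Real.norm_eq_abs]
      exact mul_le_mul_of_nonneg_right (hf x) (norm_nonneg v))

theorem mulOp_apply {d : ℕ} (M : ℕ) (f : Site d → ℝ) (hf : ∀ x, |f x| ≤ 1) (φ : Wave d M)
    (x : Site d) : mulOp M f hf φ x = (f x : ℂ) • φ x := rfl

/-- The characteristic function `χ_{x}` of one site, as a multiplication operator. -/
def siteProj {d : ℕ} (M : ℕ) (x : Site d) : Op d M :=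
  mulOp M (fun x' => if x' = x then 1 else 0) (fun x' => by split_ifs <;> simp)

/-! ### Tight-binding Hamiltonians, the Fermi level and the Fermi projection -/

/-- `H` is the operator `(H φ)_α(x) = ∑_y ∑_β t_{x,y}^{α,β} φ_β(y)` for hopping amplitudes
which are Hermitian, of finite range, and uniformly bounded. -/
def IsTightBinding {d M : ℕ} (H : Op d M) : Prop :=
  ∃ t : Site d → Site d → Fin M → Fin M → ℂ,
    (∀ x y α β, t y x β α = conj (t x y α β)) ∧
    (∃ R : ℝ, ∀ x y, R < ‖latticePoint x - latticePoint y‖ → ∀ α β, t x y α β = 0) ∧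
    (∃ t₀ : ℝ, ∀ x y α β, ‖t x y α β‖ ≤ t₀) ∧
    ∀ (φ : Wave d M) (x : Site d) (α : Fin M),
      H φ x α = ∑' y, ∑ β, t x y α β * φ y β

/-- The standing assumption on the Fermi level `E`: the resolvent `(E + iε - H)⁻¹` decays
exponentially with distance, uniformly in `ε > 0`. -/
def FermiLevelAdmissible {d M : ℕ} (H : Op d M) (E : ℝ) : Prop :=
  ∃ C ξ : ℝ, 0 < C ∧ 0 < ξ ∧ ∀ ε : ℝ, 0 < ε → ∀ x y : Site d,
    ‖siteProj M x ∘L resolvent H ((E : ℂ) + ε * Complex.I) ∘L siteProj M y‖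
      ≤ C * Real.exp (-‖latticePoint x - latticePoint y‖ / ξ)

/-- The spectral projection of a self-adjoint operator `T` on a Hilbert space onto the spectral
values below `E`. It is the orthogonal projection onto the closure of the range of the positive
part `(E - T)₊` of `E - T`. -/
def spectralProjBelow {F : Type*} [NormedAddCommGroup F] [InnerProductSpace ℂ F]
    [CompleteSpace F] (T : F →L[ℂ] F) (E : ℝ) : F →L[ℂ] F :=
  (LinearMap.range
    (cfc (fun s : ℝ => max (E - s) 0) T : F →L[ℂ] F).toLinearMap).topologicalClosure.starProjection

/-- The Fermi projection `P_F` onto the states whose energy is less than `E`. -/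
def fermiProj {d M : ℕ} (H : Op d M) (E : ℝ) : Op d M :=
  spectralProjBelow H E

/-! ### Symmetries -/

/-- The antiunitary transformation `φ ↦ U φ̄`, where the unitary matrix `U` acts on the internal
degree of freedom at each site. -/
def antiunitary {d M : ℕ} (U : Matrix.unitaryGroup (Fin M) ℂ) (φ : Wave d M) : Wave d M :=
  ⟨fun x => WithLp.toLp 2 ((U : Matrix (Fin M) (Fin M) ℂ).mulVec (fun α => conj (φ x α))), by
    refine ((lp.memℓp φ).norm.const_mul
      ‖Matrix.toEuclideanCLM (𝕜 := ℂ) (U : Matrix (Fin M) (Fin M) ℂ)‖).mono (fun x => ?_) |>.of_norm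
    have h := (Matrix.toEuclideanCLM (𝕜 := ℂ) (U : Matrix (Fin M) (Fin M) ℂ)).le_opNorm
      (WithLp.toLp 2 (fun α => conj (φ x α)))
    have h2 : ‖(WithLp.toLp 2 (fun α => conj (φ x α)) : EuclideanSpace ℂ (Fin M))‖ = ‖φ x‖ := by
      simp [EuclideanSpace.norm_eq]
    rw [h2, Matrix.toEuclideanCLM_toLp] at h
    simpa using h⟩

/-- The symmetry classes without chiral symmetry. -/
inductive SymClass : Type
  | A
  | AI
  | AII
  | C
  | D

/-- The symmetry which a Hamiltonian `H` with Fermi level `E` has in the given class. The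
antiunitary transformation defined by `U` is the time-reversal transformation for AI (even) and
AII (odd), and the particle-hole transformation for D (even) and C (odd). For the latter two
classes the Fermi level is `0`. Class A requires nothing. -/
def HasSymmetry {d M : ℕ} (U : Matrix.unitaryGroup (Fin M) ℂ) (E : ℝ) (H : Op d M) :
    SymClass → Prop
  | .A => True
  | .AI => (∀ φ : Wave d M, antiunitary U (antiunitary U φ) = φ) ∧
      ∀ φ : Wave d M, antiunitary U (H φ) = H (antiunitary U φ)
  | .AII => (∀ φ : Wave d M, antiunitary U (antiunitary U φ) = -φ) ∧
      ∀ φ : Wave d M, antiunitary U (H φ) = H (antiunitary U φ)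
  | .C => E = 0 ∧ (∀ φ : Wave d M, antiunitary U (antiunitary U φ) = -φ) ∧
      ∀ φ : Wave d M, antiunitary U (H φ) = -H (antiunitary U φ)
  | .D => E = 0 ∧ (∀ φ : Wave d M, antiunitary U (antiunitary U φ) = φ) ∧
      ∀ φ : Wave d M, antiunitary U (H φ) = -H (antiunitary U φ)

/-- The entries with the symbol `ℤ₂` in the periodic table (period 8 in the dimension), in odd
dimensions `d` for the classes without chiral symmetry. -/
def IsZ2Entry (d : ℕ) : SymClass → Prop
  | .A => False
  | .AI => d % 8 = 7
  | .AII => d % 8 = 3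
  | .C => d % 8 = 5
  | .D => d % 8 = 1

/-- Empty entries of the periodic table in odd dimensions `d` for which the parity of the kernel
is identically even (a Kramers degeneracy). -/
def IsKramersEntry (d : ℕ) : SymClass → Prop
  | .A => False
  | .AI => d % 8 = 3 ∨ d % 8 = 5
  | .AII => d % 8 = 1 ∨ d % 8 = 7
  | .C => d % 8 = 1 ∨ d % 8 = 3
  | .D => d % 8 = 5 ∨ d % 8 = 7

/-! ### Gamma matrices and the Dirac operator in dimension `2n+1` -/

/-- The standard basis of `ℂ^{2^n} = ℂ² ⊗ ⋯ ⊗ ℂ²`. -/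
abbrev Spin (n : ℕ) : Type := Fin n → Fin 2

/-- A Pauli matrix. -/
def pauli₁ : Matrix (Fin 2) (Fin 2) ℂ := !![0, 1; 1, 0]

/-- A Pauli matrix. -/
def pauli₂ : Matrix (Fin 2) (Fin 2) ℂ := !![0, -Complex.I; Complex.I, 0]

/-- A Pauli matrix. -/
def pauli₃ : Matrix (Fin 2) (Fin 2) ℂ := !![1, 0; 0, -1]

/-- The `k`-th tensor factor of the `j`-th gamma matrix, with `k = 0, …, n-1` and
`j = 0, …, 2n`. For `j = 2n` all factors are `σ₃`. For `j < 2n` the factor is `σ₀` before the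
position `j / 2`, `σ₁` (`j` even) or `σ₂` (`j` odd) at that position, and `σ₃` after it. -/
def gammaFactor (n : ℕ) (j : Fin (2 * n + 1)) (k : Fin n) : Matrix (Fin 2) (Fin 2) ℂ :=
  if j.val = 2 * n then pauli₃
  else if k.val < j.val / 2 then 1
  else if k.val = j.val / 2 then (if j.val % 2 = 0 then pauli₁ else pauli₂)
  else pauli₃

/-- The gamma matrices on `ℂ^{2^n}`, as tensor products of Pauli matrices. -/
def gamma (n : ℕ) (j : Fin (2 * n + 1)) : Matrix (Spin n) (Spin n) ℂ :=
  fun μ ν => ∏ k, gammaFactor n j k (μ k) (ν k)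

/-- The Hilbert space `ℓ²(ℤ^{2n+1}, ℂ^M) ⊗ ℂ^{2^n}`. -/
abbrev SpinWave (n M : ℕ) : Type := PiLp 2 (fun _ : Spin n => Wave (2 * n + 1) M)

/-- Bounded operators on `ℓ²(ℤ^{2n+1}, ℂ^M) ⊗ ℂ^{2^n}`. -/
abbrev SpinOp (n M : ℕ) : Type := SpinWave n M →L[ℂ] SpinWave n M

/-- The operator `T ⊗ G`, i.e. `((T ⊗ G) φ)_μ = ∑_ν G_{μν} T φ_ν`. -/
def tensorOp {n M : ℕ} (T : Op (2 * n + 1) M) (G : Matrix (Spin n) (Spin n) ℂ) : SpinOp n M :=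
  ((PiLp.continuousLinearEquiv 2 ℂ (fun _ : Spin n => Wave (2 * n + 1) M)).symm :
      (Spin n → Wave (2 * n + 1) M) →L[ℂ] SpinWave n M) ∘L
    (ContinuousLinearMap.pi fun μ => ∑ ν, G μ ν •
      (T ∘L ContinuousLinearMap.proj (R := ℂ) (φ := fun _ : Spin n => Wave (2 * n + 1) M) ν)) ∘L
    ((PiLp.continuousLinearEquiv 2 ℂ (fun _ : Spin n => Wave (2 * n + 1) M)) :
      SpinWave n M →L[ℂ] (Spin n → Wave (2 * n + 1) M))

/-- The `j`-th component of the unit vector `(x - a) / |x - a|`. -/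
def unitCoord {d : ℕ} (a : EuclideanSpace ℝ (Fin d)) (j : Fin d) (x : Site d) : ℝ :=
  (latticePoint x - a) j / ‖latticePoint x - a‖

theorem abs_unitCoord_le_one {d : ℕ} (a : EuclideanSpace ℝ (Fin d)) (j : Fin d) (x : Site d) :
    |unitCoord a j x| ≤ 1 := by
  rw [unitCoord, abs_div, abs_norm]
  exact div_le_one_of_le₀ (PiLp.norm_apply_le (latticePoint x - a) j) (norm_nonneg _)

/-- The Dirac operator `D_a(x) = |x - a|⁻¹ (x - a) · γ`. -/
def dirac (n M : ℕ) (a : EuclideanSpace ℝ (Fin (2 * n + 1))) : SpinOp n M :=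
  ∑ j, tensorOp (mulOp M (unitCoord a j) (abs_unitCoord_le_one a j)) (gamma n j)

/-! ### The indices -/

/-- The operator `P_F - D_a P_F D_a`, where `P_F` stands for `P_F ⊗ 1`. -/
def projDiff {n M : ℕ} (a : EuclideanSpace ℝ (Fin (2 * n + 1))) (H : Op (2 * n + 1) M) (E : ℝ) :
    SpinOp n M :=
  tensorOp (fermiProj H E) 1 - dirac n M a ∘L tensorOp (fermiProj H E) 1 ∘L dirac n M a

/-- The eigenspace `ker [(P_F - D_a P_F D_a) - s]`. -/
def indexKer {n M : ℕ} (a : EuclideanSpace ℝ (Fin (2 * n + 1))) (H : Op (2 * n + 1) M) (E : ℝ)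
    (s : ℂ) : Submodule ℂ (SpinWave n M) :=
  LinearMap.ker (projDiff a H E - s • ContinuousLinearMap.id ℂ (SpinWave n M)).toLinearMap

/-- The integer-valued index `dim ker (A - 1) - dim ker (A + 1)` of `A = P_F - D_a P_F D_a`. -/
def intIndex {n M : ℕ} (a : EuclideanSpace ℝ (Fin (2 * n + 1))) (H : Op (2 * n + 1) M) (E : ℝ) :
    ℤ :=
  (Module.finrank ℂ (indexKer a H E 1) : ℤ) - (Module.finrank ℂ (indexKer a H E (-1)) : ℤ)

/-- The `ℤ₂` index `dim ker [(P_F - D_a P_F D_a) - 1]` modulo 2. -/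
def z2Index {n M : ℕ} (a : EuclideanSpace ℝ (Fin (2 * n + 1))) (H : Op (2 * n + 1) M) (E : ℝ) :
    ZMod 2 :=
  (Module.finrank ℂ (indexKer a H E 1) : ZMod 2)

end OddTI

end

/-! Write `P` for `P_F ⊗ 1`, `D` for the Dirac operator, `A = P - DPD` and `B = 1 - P - DPD`. Since
`D² = 1` and `P² = P`, one has `A² + B² = 1`, `AB = -BA`, `DA = -AD` and `DB = BD`. Hence `D`
exchanges `ker (A - 1)` and `ker (A + 1)`, and the integer index vanishes.

Analysis. Decay of the resolvent, uniform in `ε`, and the Schur test open a spectral gap at `E`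
(`FermiLevelAdmissible.exists_gap`), so `P_F` is a continuous function of `H`
(`spectralProjBelow_eq_cfc`). It therefore depends norm-continuously on `H`, respects the
antiunitary symmetry, and has compact commutator with `D`, because `H` has finite range and `(x - a)
/ |x - a|` varies slowly at infinity. So `A = D [D, P]` is compact (`isCompactOperator_projDiff`).

Symmetry. The transformation `X = Θ ⊗ C K` satisfies `XD = (-1)ⁿ DX` and `X² = ±1`, with signs of
period 8 in `d`. At a `ℤ₂` entry, `W = DBX` (`X` preserves `P`) or `W = BX` (`X` maps `P` to `1 -
P`) is antilinear, commutes with `A`, and `W² = -B² = -(1 - A²)`. At a Kramers entry, `W = X` or `W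
= DX` commutes with `A` and `W² = -1`.

Parity. If `W` is antilinear on a finite-dimensional space and `W² = -T` with `T ≥ 0`, then the rank
of `T` is even (`finrank_eq_finrank_ker_of_antilinear_sq`). With `T = 1` this is Kramers degeneracy.
With `T = 1 - A²` it says that the eigenvalues of `A` just below `1` have even total multiplicity.
Under a small perturbation the total multiplicity near `1` is preserved, and eigenvalues leave `1`
only in even number, so the parity of `dim ker (A - 1)` is stable (`exists_parity_stable`). Along a
path it is locally constant, hence constant. -/

open scoped InnerProductSpace ComplexConjugate

noncomputable section

namespace OddTI

/-! ### Functional calculus: the spectral gap and the Fermi projection as a continuous function of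
`T`. -/

section FunctionalCalculus

variable {F : Type*} [NormedAddCommGroup F] [InnerProductSpace ℂ F] [CompleteSpace F]

theorem isUnit_of_isSelfAdjoint_of_boundedBelow {S : F →L[ℂ] F} (hS : IsSelfAdjoint S) {g : ℝ}
    (hg : 0 < g) (h : ∀ v, g * ‖v‖ ≤ ‖S v‖) : IsUnit S := by
  have h2 : IsUnit (S * S) := by
    refine ContinuousLinearMap.isUnit_of_forall_le_norm_inner_map (S * S)
      (c := ⟨g ^ 2, by positivity⟩) (by exact_mod_cast pow_pos hg 2) fun v => ?_
    have h3 : ⟪(S * S) v, v⟫_ℂ = ⟪S v, S v⟫_ℂ := by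
      have := hS.isSymmetric (S v) v
      simpa using this
    rw [h3, inner_self_eq_norm_sq_to_K]
    simp only [norm_pow, Complex.coe_algebraMap, Complex.norm_real, norm_norm]
    change ‖v‖ ^ 2 * g ^ 2 ≤ ‖S v‖ ^ 2
    rw [← mul_pow, mul_comm]
    exact pow_le_pow_left₀ (by positivity) (h v) 2
  exact ((Commute.refl S).isUnit_mul_iff.1 h2).1

theorem notMem_spectrum_of_boundedBelow {T : F →L[ℂ] F} (hT : IsSelfAdjoint T) {E g z : ℝ}
    (h : ∀ v, g * ‖v‖ ≤ ‖(E : ℂ) • v - T v‖) (hz : |z - E| < g) : z ∉ spectrum ℝ T := by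
  rw [spectrum.notMem_iff]
  have hsa : IsSelfAdjoint (algebraMap ℝ (F →L[ℂ] F) z - T) :=
    (IsSelfAdjoint.algebraMap _ (IsSelfAdjoint.all z)).sub hT
  refine isUnit_of_isSelfAdjoint_of_boundedBelow hsa (sub_pos.2 hz) fun v => ?_
  have h1 : (algebraMap ℝ (F →L[ℂ] F) z - T) v = ((E : ℂ) • v - T v) + ((z - E : ℝ) : ℂ) • v := by
    have : (algebraMap ℝ (F →L[ℂ] F) z) v = (z : ℂ) • v := by
      rw [Algebra.algebraMap_eq_smul_one]; simp
    rw [sub_apply, this]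
    push_cast
    module
  have h2 : ‖((z - E : ℝ) : ℂ) • v‖ = |z - E| * ‖v‖ := by
    rw [norm_smul, Complex.norm_real, Real.norm_eq_abs]
  rw [h1]
  have h3 := norm_sub_le_norm_add ((E : ℂ) • v - T v) (((z - E : ℝ) : ℂ) • v)
  have := h v
  linarith

/-- Weierstrass approximation. One polynomial serves every `T` in the ball of radius `R`, which
allows two operators to be compared through it. -/
theorem exists_polynomial_approx_cfc (f : ℝ → ℝ) (hf : Continuous f) (R : ℝ) {ε : ℝ}
    (hε : 0 < ε) : ∃ p : Polynomial ℝ, ∀ T : F →L[ℂ] F, IsSelfAdjoint T → ‖T‖ ≤ R →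
      ‖cfc f T - Polynomial.aeval T p‖ ≤ ε := by
  obtain ⟨p, hp⟩ := exists_polynomial_near_of_continuousOn (-R) R f hf.continuousOn ε hε
  refine ⟨p, fun T hT hTR => ?_⟩
  rw [← cfc_polynomial p T hT, ← cfc_sub f p.eval T hf.continuousOn p.continuous.continuousOn]
  refine norm_cfc_le hε.le fun x hx => ?_
  have hxR : |x| ≤ R := by
    have h1 := spectrum.norm_le_norm_mul_of_mem hx
    -- Only an inequality, since `F` may be the zero space.
    have h2 : ‖(1 : F →L[ℂ] F)‖ ≤ 1 := ContinuousLinearMap.norm_id_le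
    have h3 := norm_nonneg T
    rw [Real.norm_eq_abs] at h1
    nlinarith
  rw [Real.norm_eq_abs, abs_sub_comm]
  exact (hp x (abs_le.1 hxR)).le

theorem exists_norm_cfc_sub_lt (f : ℝ → ℝ) (hf : Continuous f) (T : F →L[ℂ] F)
    (hT : IsSelfAdjoint T) {ε : ℝ} (hε : 0 < ε) :
    ∃ δ : ℝ, 0 < δ ∧ ∀ T' : F →L[ℂ] F, IsSelfAdjoint T' → ‖T' - T‖ < δ →
      ‖cfc f T' - cfc f T‖ < ε := by
  obtain ⟨p, hp⟩ := exists_polynomial_approx_cfc (F := F) f hf (‖T‖ + 1) (ε := ε / 4)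
    (by positivity)
  have hc : Continuous fun S : F →L[ℂ] F => Polynomial.aeval S p := p.continuous_aeval
  obtain ⟨δ, hδ, h⟩ := Metric.continuous_iff.1 hc T (ε / 4) (by positivity)
  refine ⟨min δ 1, lt_min hδ one_pos, fun T' hT' hd => ?_⟩
  have h1 := h T' (by rw [dist_eq_norm]; exact hd.trans_le (min_le_left _ _))
  have h2 : ‖T'‖ ≤ ‖T‖ + 1 := by
    have := norm_sub_norm_le T' T
    have := hd.trans_le (min_le_right _ _)
    linarith
  have h3 := hp T' hT' h2
  have h4 := hp T hT (by linarith)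
  rw [dist_eq_norm] at h1
  rw [norm_sub_rev] at h4
  calc ‖cfc f T' - cfc f T‖ = ‖(cfc f T' - Polynomial.aeval T' p) +
        (Polynomial.aeval T' p - Polynomial.aeval T p) + (Polynomial.aeval T p - cfc f T)‖ := by
        congr 1; abel
    _ ≤ ‖cfc f T' - Polynomial.aeval T' p‖ + ‖Polynomial.aeval T' p - Polynomial.aeval T p‖ +
        ‖Polynomial.aeval T p - cfc f T‖ := norm_add₃_le
    _ < ε := by linarith

omit [CompleteSpace F] in
theorem antilinear_intertwines_aeval (X : F →L⋆[ℂ] F) {T T' : F →L[ℂ] F}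
    (h : ∀ v, X (T v) = T' (X v)) (p : Polynomial ℝ) (v : F) :
    X (Polynomial.aeval T p v) = Polynomial.aeval T' p (X v) := by
  induction p using Polynomial.induction_on' generalizing v with
  | add p q hp hq => simp [hp, hq]
  | monomial n r =>
    have hpow : ∀ v, X ((T ^ n) v) = (T' ^ n) (X v) := by
      induction n with
      | zero => simp
      | succ n ih =>
        intro v
        rw [pow_succ, pow_succ, mul_apply_eq_comp, mul_apply_eq_comp, ih, h]
    have hr : ∀ w, X (r • w) = r • X w := fun w => by
      rw [← Complex.coe_smul, ← Complex.coe_smul, X.map_smulₛₗ, Complex.conj_ofReal]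
    rw [Polynomial.aeval_monomial, Polynomial.aeval_monomial, Algebra.algebraMap_eq_smul_one,
      smul_mul_assoc, smul_mul_assoc, one_mul, one_mul, smul_apply, smul_apply,
      hr, hpow]

/-- Real polynomials pass through an antilinear map because their coefficients are fixed by
conjugation; the general case is their norm limit. -/
theorem antilinear_intertwines_cfc (X : F →L⋆[ℂ] F) {T T' : F →L[ℂ] F}
    (hT : IsSelfAdjoint T) (hT' : IsSelfAdjoint T') (h : ∀ v, X (T v) = T' (X v))
    (f : ℝ → ℝ) (hf : Continuous f) (v : F) :
    X (cfc f T v) = cfc f T' (X v) := by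
  rw [← sub_eq_zero, ← norm_le_zero_iff]
  refine le_of_forall_pos_le_add fun ε hε => ?_
  have hpos : 0 < ‖X‖ * ‖v‖ + ‖X v‖ + 1 := by positivity
  obtain ⟨p, hp⟩ := exists_polynomial_approx_cfc (F := F) f hf (max ‖T‖ ‖T'‖)
    (ε := ε / (‖X‖ * ‖v‖ + ‖X v‖ + 1)) (by positivity)
  set η := ε / (‖X‖ * ‖v‖ + ‖X v‖ + 1) with hη
  have hη0 : 0 ≤ η := by positivity
  have h1 := hp T hT (le_max_left _ _)
  have h2 := hp T' hT' (le_max_right _ _)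
  have h3 : X (cfc f T v) - cfc f T' (X v) =
      X ((cfc f T - Polynomial.aeval T p) v) - (cfc f T' - Polynomial.aeval T' p) (X v) := by
    simp [antilinear_intertwines_aeval X h p v]
  have h4 : ‖X ((cfc f T - Polynomial.aeval T p) v)‖ ≤ ‖X‖ * (η * ‖v‖) :=
    X.le_opNorm_of_le (ContinuousLinearMap.le_of_opNorm_le _ h1 v)
  have h5 : ‖(cfc f T' - Polynomial.aeval T' p) (X v)‖ ≤ η * ‖X v‖ :=
    ContinuousLinearMap.le_of_opNorm_le _ h2 _
  have h6 : η * (‖X‖ * ‖v‖ + ‖X v‖ + 1) = ε := by rw [hη]; field_simp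
  rw [h3, zero_add]
  refine (norm_sub_le _ _).trans ?_
  nlinarith

omit [CompleteSpace F] in
theorem isCompactOperator_commutator_aeval {u T : F →L[ℂ] F}
    (h : IsCompactOperator (u * T - T * u)) (p : Polynomial ℝ) :
    IsCompactOperator (u * Polynomial.aeval T p - Polynomial.aeval T p * u) := by
  induction p using Polynomial.induction_on' with
  | add p q hp hq =>
    have e : u * Polynomial.aeval T (p + q) - Polynomial.aeval T (p + q) * u =
        (u * Polynomial.aeval T p - Polynomial.aeval T p * u) +
        (u * Polynomial.aeval T q - Polynomial.aeval T q * u) := by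
      rw [map_add]
      noncomm_ring
    rw [e]
    exact hp.add hq
  | monomial n r =>
    have hpow : IsCompactOperator (u * T ^ n - T ^ n * u) := by
      induction n with
      | zero => simpa using isCompactOperator_zero
      | succ n ih =>
        have e : u * T ^ (n + 1) - T ^ (n + 1) * u =
            (u * T ^ n - T ^ n * u) * T + T ^ n * (u * T - T * u) := by
          rw [pow_succ]
          noncomm_ring
        rw [e]
        exact (ih.comp_clm T).add (h.clm_comp (T ^ n))
    have e : u * Polynomial.aeval T (Polynomial.monomial n r) -
        Polynomial.aeval T (Polynomial.monomial n r) * u = r • (u * T ^ n - T ^ n * u) := by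
      rw [Polynomial.aeval_monomial, Algebra.algebraMap_eq_smul_one, smul_mul_assoc, one_mul,
        mul_smul_comm, smul_mul_assoc, smul_sub]
    rw [e]
    exact hpow.smul r

/-- By the Leibniz rule the commutator with a polynomial in `T` is compact, and compact operators
are closed in norm. -/
theorem isCompactOperator_commutator_cfc {u T : F →L[ℂ] F} (hT : IsSelfAdjoint T)
    (h : IsCompactOperator (u * T - T * u)) (f : ℝ → ℝ) (hf : Continuous f) :
    IsCompactOperator (u * cfc f T - cfc f T * u) := by
  have hcl : IsClosed {S : F →L[ℂ] F | IsCompactOperator S} := isClosed_setOfPred_isCompactOperator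
  change _ ∈ {S : F →L[ℂ] F | IsCompactOperator S}
  rw [← hcl.closure_eq, Metric.mem_closure_iff]
  intro ε hε
  obtain ⟨p, hp⟩ := exists_polynomial_approx_cfc (F := F) f hf ‖T‖
    (ε := ε / (2 * ‖u‖ + 1)) (by positivity)
  refine ⟨_, isCompactOperator_commutator_aeval h p, ?_⟩
  have h1 := hp T hT le_rfl
  rw [dist_eq_norm]
  have h2 : (u * cfc f T - cfc f T * u) -
      (u * Polynomial.aeval T p - Polynomial.aeval T p * u) =
      u * (cfc f T - Polynomial.aeval T p) - (cfc f T - Polynomial.aeval T p) * u := by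
    noncomm_ring
  rw [h2]
  have h3 := norm_mul_le u (cfc f T - Polynomial.aeval T p)
  have h4 := norm_mul_le (cfc f T - Polynomial.aeval T p) u
  have h5 := norm_sub_le (u * (cfc f T - Polynomial.aeval T p))
    ((cfc f T - Polynomial.aeval T p) * u)
  set η := ε / (2 * ‖u‖ + 1) with hη
  have h6 : η * (2 * ‖u‖ + 1) = ε := by rw [hη]; field_simp
  have h7 : 0 < η := by positivity
  have := norm_nonneg u
  nlinarith

/-- A continuous function equal to `1` below `E - g` and to `0` above `E`. -/
def gapStep (E g : ℝ) (s : ℝ) : ℝ := max (E - s) 0 * (max g (E - s))⁻¹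

theorem continuous_max_inv {E g : ℝ} (hg : 0 < g) :
    Continuous fun s : ℝ => (max g (E - s))⁻¹ := by
  refine Continuous.inv₀ (by fun_prop) fun s => ?_
  exact (lt_max_of_lt_left hg).ne'

theorem continuous_gapStep {E g : ℝ} (hg : 0 < g) : Continuous (gapStep E g) := by
  unfold gapStep
  exact Continuous.mul (by fun_prop) (continuous_max_inv hg)

theorem gapStep_eq_one {E g s : ℝ} (hg : 0 < g) (h : g ≤ E - s) : gapStep E g s = 1 := by
  rw [gapStep, max_eq_right h, max_eq_left (by linarith), mul_inv_cancel₀ (by linarith)]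

theorem gapStep_eq_zero {E g s : ℝ} (h : E - s ≤ 0) : gapStep E g s = 0 := by
  rw [gapStep, max_eq_right h, zero_mul]

theorem gapStep_dichotomy {T : F →L[ℂ] F} (hT : IsSelfAdjoint T) {E g : ℝ}
    (h : ∀ v, g * ‖v‖ ≤ ‖(E : ℂ) • v - T v‖) {s : ℝ} (hs : s ∈ spectrum ℝ T) :
    g ≤ E - s ∨ g ≤ s - E := by
  by_contra! hcon
  exact notMem_spectrum_of_boundedBelow hT h (abs_lt.2 ⟨by linarith, by linarith⟩) hs

/-- The two functions differ inside the gap but agree on the spectrum, which avoids `(-g, g)`. This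
is how a particle-hole symmetry exchanges `P` and `1 - P`. -/
theorem cfc_gapStep_neg {T : F →L[ℂ] F} (hT : IsSelfAdjoint T) {E g : ℝ} (hg : 0 < g)
    (h : ∀ v, g * ‖v‖ ≤ ‖(E : ℂ) • v - T v‖) (hE : E = 0) :
    cfc (gapStep E g) (-T) = 1 - cfc (gapStep E g) T := by
  have hcont := continuous_gapStep (E := E) hg
  rw [← cfc_comp_neg (gapStep E g) T hcont.continuousOn hT, ← cfc_const_one ℝ T,
    ← cfc_sub (fun _ : ℝ => 1) (gapStep E g) T (by fun_prop) hcont.continuousOn]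
  refine cfc_congr fun s hs => ?_
  rcases gapStep_dichotomy hT h hs with h | h
  · simp only [gapStep_eq_one hg h, gapStep_eq_zero (show E - -s ≤ 0 by linarith), sub_self]
  · simp only [gapStep_eq_one hg (show g ≤ E - -s by linarith),
      gapStep_eq_zero (show E - s ≤ 0 by linarith), sub_zero]

/-- On the spectrum the step takes only the values `0` and `1`, so `p` is an orthogonal projection.
It is a multiple of the positive part `k`, and `p k = k`, so both have the same range. -/
theorem spectralProjBelow_eq_cfc {T : F →L[ℂ] F} (hT : IsSelfAdjoint T) {E g : ℝ} (hg : 0 < g)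
    (h : ∀ v, g * ‖v‖ ≤ ‖(E : ℂ) • v - T v‖) :
    spectralProjBelow T E = cfc (gapStep E g) T := by
  set p := cfc (gapStep E g) T with hp
  set k := cfc (fun s : ℝ => max (E - s) 0) T with hk
  have hpk : p = k * cfc (fun s : ℝ => (max g (E - s))⁻¹) T := by
    rw [hp, hk, ← cfc_mul _ _ T (by fun_prop) (continuous_max_inv hg).continuousOn]
    rfl
  have hcg := (continuous_gapStep (E := E) hg).continuousOn (s := spectrum ℝ T)
  have hkp : p * k = k := by
    rw [hp, hk, ← cfc_mul _ _ T hcg (by fun_prop)]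
    refine cfc_congr fun s hs => ?_
    rcases gapStep_dichotomy hT h hs with h1 | h1
    · simp [gapStep_eq_one hg h1]
    · simp [max_eq_right (show E - s ≤ 0 by linarith)]
  have hpp : p * p = p := by
    rw [hp, ← cfc_mul _ _ T hcg hcg]
    refine cfc_congr fun s hs => ?_
    rcases gapStep_dichotomy hT h hs with h1 | h1
    · simp [gapStep_eq_one hg h1]
    · simp [gapStep_eq_zero (show E - s ≤ 0 by linarith)]
  have hpsa : IsSelfAdjoint p := cfc_predicate _ _
  have hrange : LinearMap.range k.toLinearMap = LinearMap.range p.toLinearMap := by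
    apply le_antisymm
    · rintro _ ⟨v, rfl⟩
      exact ⟨k v, by simpa using congrArg (fun S : F →L[ℂ] F => S v) hkp⟩
    · rintro _ ⟨v, rfl⟩
      exact ⟨cfc (fun s : ℝ => (max g (E - s))⁻¹) T v,
        by simpa using (congrArg (fun S : F →L[ℂ] F => S v) hpk).symm⟩
  ext v
  rw [spectralProjBelow]
  apply Submodule.eq_starProjection_of_mem_of_inner_eq_zero
  · apply Submodule.le_topologicalClosure
    rw [← hk, hrange]
    exact ⟨v, rfl⟩
  · intro w hw
    have hclosed : IsClosed {w : F | ⟪v - p v, w⟫_ℂ = 0} :=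
      isClosed_eq (by fun_prop) continuous_const
    have hsub : ((LinearMap.range k.toLinearMap : Submodule ℂ F) : Set F) ⊆
        {w : F | ⟪v - p v, w⟫_ℂ = 0} := by
      rw [hrange]
      rintro _ ⟨u, rfl⟩
      have h1 := hpsa.isSymmetric (v - p v) u
      have h2 : p (p v) = p v := by simpa using congrArg (fun S : F →L[ℂ] F => S v) hpp
      simp only [Set.mem_ofPred_eq]
      change ⟪v - p v, p u⟫_ℂ = 0
      have h1' : ⟪p (v - p v), u⟫_ℂ = ⟪v - p v, p u⟫_ℂ := h1
      rw [← h1', map_sub, h2, sub_self, inner_zero_left]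
    exact closure_minimal hsub hclosed hw

end FunctionalCalculus

/-! ### Parity of the dimension from an antilinear square root. -/

section Parity

open scoped ComplexOrder

variable {V : Type*} [NormedAddCommGroup V] [InnerProductSpace ℂ V] [FiniteDimensional ℂ V]

/-- In an orthonormal basis `W` is `M` followed by conjugation of coordinates, so `M M̄ = -N`.
Determinants give `|det M|² = (-1)^dim · det N` with `det N > 0`, impossible in odd dimension. -/
theorem even_finrank_of_antilinear_sq (W : V →ₗ⋆[ℂ] V) (T : V →ₗ[ℂ] V) (hT : T.IsPositive)
    (hinj : Function.Injective T) (hW : ∀ v, W (W v) = -T v) : Even (Module.finrank ℂ V) := by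
  by_contra hodd
  rw [Nat.not_even_iff_odd] at hodd
  set b := (stdOrthonormalBasis ℂ V).toBasis with hb
  set M : Matrix _ _ ℂ := Matrix.of fun i j => b.repr (W (b j)) i with hM
  set N := LinearMap.toMatrix b b T with hN
  have hWb : ∀ j, W (b j) = ∑ k, M k j • b k := fun j => by
    simp [hM, b.sum_repr]
  have hMN : M * M.map (starRingEnd ℂ) = -N := by
    ext i j
    have h1 : W (W (b j)) = ∑ k, conj (M k j) • W (b k) := by
      rw [hWb, map_sum]
      simp
    have h2 : b.repr (W (W (b j))) i = ∑ k, conj (M k j) * M i k := by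
      rw [h1, map_sum]
      simp [hM]
    rw [hW] at h2
    rw [Matrix.mul_apply, Matrix.neg_apply, hN, LinearMap.toMatrix_apply]
    simp only [map_neg, Finsupp.coe_neg, Pi.neg_apply] at h2
    rw [h2]
    exact Finset.sum_congr rfl fun k _ => by simp [mul_comm]
  have hdet := congrArg Matrix.det hMN
  rw [Matrix.det_mul, Matrix.det_neg, Fintype.card_fin, hodd.neg_one_pow] at hdet
  have hconj : (M.map (starRingEnd ℂ)).det = conj M.det := by
    rw [RingHom.map_det]; rfl
  rw [hconj, Complex.mul_conj] at hdet
  have hpos : 0 ≤ N.det :=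
    ((LinearMap.posSemidef_toMatrix_iff (stdOrthonormalBasis ℂ V)).2 hT).det_nonneg
  have h0 : N.det ≠ 0 := by
    rw [hN, LinearMap.det_toMatrix]
    have : IsUnit T := (LinearMap.isUnit_iff_ker_eq_bot T).2 (LinearMap.ker_eq_bot.2 hinj)
    exact (this.map LinearMap.det).ne_zero
  have h1 : (0 : ℂ) ≤ (Complex.normSq M.det : ℂ) := by
    exact_mod_cast Complex.normSq_nonneg _
  rw [hdet, neg_one_mul, neg_nonneg] at h1
  exact h0 (le_antisymm h1 hpos)

/-- `W` commutes with `T = -W²`, hence preserves the range of `T`. There `T` is injective by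
symmetry, so the rank of `T` is even. -/
theorem finrank_eq_finrank_ker_of_antilinear_sq (W : V →ₗ⋆[ℂ] V) (T : V →ₗ[ℂ] V)
    (hT : T.IsPositive) (hW : ∀ v, W (W v) = -T v) :
    (Module.finrank ℂ V : ZMod 2) = (Module.finrank ℂ (LinearMap.ker T) : ZMod 2) := by
  have hcomm : ∀ v, W (T v) = T (W v) := fun v => by
    have h1 := hW (W v)
    rw [hW v, map_neg, neg_inj] at h1
    exact h1
  have hmem : ∀ v : LinearMap.range T, (W.comp (LinearMap.range T).subtype) v ∈
      LinearMap.range T := by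
    rintro ⟨_, v, rfl⟩
    exact ⟨W v, (hcomm v).symm⟩
  have hker : ∀ v, T (T v) = 0 → T v = 0 := fun v hv => by
    rw [← inner_self_eq_zero (𝕜 := ℂ), hT.1, hv, inner_zero_right]
  have heven := even_finrank_of_antilinear_sq
    (LinearMap.codRestrict (LinearMap.range T) (W.comp (LinearMap.range T).subtype) hmem)
    (T.restrict (p := LinearMap.range T) (q := LinearMap.range T) fun v _ => ⟨v, rfl⟩)
    ⟨fun v w => hT.1 v w, fun v => hT.2 v⟩
    (by
      rw [← LinearMap.ker_eq_bot, LinearMap.ker_eq_bot']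
      rintro ⟨_, v, rfl⟩ hv
      exact Subtype.ext (hker v (congrArg Subtype.val hv)))
    (fun v => Subtype.ext (hW v))
  have hsum := LinearMap.finrank_range_add_finrank_ker T
  rw [← hsum, Nat.cast_add, (ZMod.natCast_eq_zero_iff_even).2 heven, zero_add]

end Parity

/-! ### Eigenspaces of compact operators and comparison of dimensions. -/

section Eigenspaces

variable {F : Type*} [NormedAddCommGroup F] [InnerProductSpace ℂ F]

/-- The eigenspace of a bounded operator. -/
def eigenKer (A : F →L[ℂ] F) (s : ℂ) : Submodule ℂ F :=
  LinearMap.ker (A - s • ContinuousLinearMap.id ℂ F).toLinearMap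

theorem mem_eigenKer {A : F →L[ℂ] F} {s : ℂ} {v : F} : v ∈ eigenKer A s ↔ A v = s • v := by
  simp [eigenKer, sub_eq_zero]

theorem mem_eigenKer_one {A : F →L[ℂ] F} {v : F} : v ∈ eigenKer A 1 ↔ A v = v := by
  rw [mem_eigenKer, one_smul]

theorem isClosed_eigenKer (A : F →L[ℂ] F) (s : ℂ) : IsClosed (eigenKer A s : Set F) :=
  (A - s • ContinuousLinearMap.id ℂ F).isClosed_ker

/-- On the eigenspace the identity is `s⁻¹ A`, hence compact. -/
theorem finiteDimensional_eigenKer {A : F →L[ℂ] F} (hc : IsCompactOperator A) {s : ℂ}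
    (hs : s ≠ 0) : FiniteDimensional ℂ (eigenKer A s) := by
  apply FiniteDimensional.of_isCompactOperator_id
  have h1 : IsCompactOperator (A.comp (eigenKer A s).subtypeL) := hc.comp_clm _
  have h2 := h1.smul s⁻¹
  have h3 : ∀ v : eigenKer A s, (s⁻¹ • ⇑(A.comp (eigenKer A s).subtypeL)) v ∈ eigenKer A s :=
    fun v => by
      have : A v = s • (v : F) := mem_eigenKer.1 v.2
      simp [this, smul_smul, inv_mul_cancel₀ hs]
  have h4 : (id : eigenKer A s → eigenKer A s) = Set.codRestrict _ _ h3 := by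
    funext v
    have : A v = s • (v : F) := mem_eigenKer.1 v.2
    exact Subtype.ext (by simp [this, smul_smul, inv_mul_cancel₀ hs])
  rw [h4]
  exact h2.codRestrict h3 (isClosed_eigenKer A s)

/-- The hypothesis makes the orthogonal projection onto `N` injective on `U`. -/
theorem finrank_le_of_orthogonal_eq_zero {U N : Submodule ℂ F} [FiniteDimensional ℂ N]
    (h : ∀ u ∈ U, (∀ w ∈ N, ⟪w, u⟫_ℂ = 0) → u = 0) :
    FiniteDimensional ℂ U ∧ Module.finrank ℂ U ≤ Module.finrank ℂ N := by
  set f : U →ₗ[ℂ] N := (LinearMap.codRestrict N N.starProjection.toLinearMap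
    (fun v => N.starProjection_apply_mem v)).comp U.subtype with hf
  have hinj : Function.Injective f := by
    rw [← LinearMap.ker_eq_bot, LinearMap.ker_eq_bot']
    intro u hu
    have hu' : N.starProjection (u : F) = 0 := congrArg Subtype.val hu
    refine Subtype.ext (h u u.2 ?_)
    rwa [Submodule.starProjection_apply_eq_zero_iff, Submodule.mem_orthogonal] at hu'
  exact ⟨FiniteDimensional.of_injective f hinj, LinearMap.finrank_le_finrank_of_injective hinj⟩

end Eigenspaces

/-! ### Stability of the parity of the eigenvalue `1`. -/

section Stability

variable {F : Type*} [NormedAddCommGroup F] [InnerProductSpace ℂ F] [CompleteSpace F]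

/-- Subtracting the projection onto `ker (A - 1)` leaves a compact operator without the eigenvalue
`1`, so by the Fredholm alternative `‖A v - v‖ ≥ κ ‖v‖` on the orthogonal complement. -/
theorem exists_form_bound_of_isCompactOperator {A : F →L[ℂ] F} (hA : IsSelfAdjoint A)
    (hc : IsCompactOperator A) (hn : ∀ v, ‖A v‖ ≤ ‖v‖) :
    ∃ c : ℝ, 0 ≤ c ∧ c < 1 ∧ ∀ v, (∀ w ∈ eigenKer A 1, ⟪w, v⟫_ℂ = 0) →
      (⟪A v, v⟫_ℂ).re ≤ c * ‖v‖ ^ 2 := by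
  have : FiniteDimensional ℂ (eigenKer A 1) := finiteDimensional_eigenKer hc one_ne_zero
  set N := eigenKer A 1 with hN
  have hQ : IsCompactOperator N.starProjection := by
    have h1 : IsCompactOperator (N.subtypeL : N →L[ℂ] F) := by
      have : ProperSpace N := FiniteDimensional.proper ℂ N
      exact isCompactOperator_of_locallyCompactSpace_rng N.subtypeL
    exact h1.comp_clm N.orthogonalProjectionOnto
  have hne : ¬ Module.End.HasEigenvalue ((A - N.starProjection : F →L[ℂ] F) : Module.End ℂ F)
      1 := by
    intro hev
    obtain ⟨v, hv⟩ := hev.exists_hasEigenvector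
    have hv1 : A v - N.starProjection v = v := by simpa using hv.apply_eq_smul
    have hort : ∀ w ∈ N, ⟪w, v⟫_ℂ = 0 := fun w hw => by
      have hw1 : A w = w := mem_eigenKer_one.1 hw
      have h1 : ⟪w, A v⟫_ℂ = ⟪w, v⟫_ℂ := by
        have := hA.isSymmetric w v
        simp only [ContinuousLinearMap.coe_coe, hw1] at this
        exact this.symm
      have h2 : ⟪w, N.starProjection v⟫_ℂ = ⟪w, v⟫_ℂ := by
        rw [← Submodule.inner_starProjection_left_eq_right,
          Submodule.starProjection_eq_self_iff.2 hw]
      rw [← hv1, inner_sub_right, h1, h2, sub_self]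
    have hQv : N.starProjection v = 0 :=
      (Submodule.starProjection_apply_eq_zero_iff _).2 ((Submodule.mem_orthogonal _ _).2 hort)
    rw [hQv, sub_zero] at hv1
    exact hv.2 (inner_self_eq_zero.1 (hort v (mem_eigenKer_one.2 hv1)))
  have hcomp : IsCompactOperator (A - N.starProjection : F →L[ℂ] F) := hc.sub hQ
  have hb := IsCompactOperator.antilipschitz_of_not_hasEigenvalue hcomp one_ne_zero hne
  rw [antilipschitzWith_iff_exists_mul_le_norm] at hb
  obtain ⟨κ, hκ, hb⟩ := hb
  -- Expanding `κ² ‖v‖² ≤ ‖A v - v‖²` with `‖A v‖ ≤ ‖v‖` yields `1 - κ² / 2`; the maximum with `0`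
  -- keeps the later threshold `m` nonnegative.
  refine ⟨max (1 - κ ^ 2 / 2) 0, le_max_right _ _, max_lt (by nlinarith) one_pos, fun v hv => ?_⟩
  have hQv : N.starProjection v = 0 :=
    (Submodule.starProjection_apply_eq_zero_iff _).2 ((Submodule.mem_orthogonal _ _).2 hv)
  have h1 := hb v
  simp only [one_smul, sub_apply, hQv, sub_zero, one_apply_eq_self] at h1
  have h2 : ‖A v - v‖ ^ 2 = ‖A v‖ ^ 2 - 2 * (⟪A v, v⟫_ℂ).re + ‖v‖ ^ 2 := norm_sub_sq (𝕜 := ℂ) _ _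
  have h3 : ‖A v‖ ^ 2 ≤ ‖v‖ ^ 2 := pow_le_pow_left₀ (norm_nonneg _) (hn v) 2
  have h4 : (κ * ‖v‖) ^ 2 ≤ ‖A v - v‖ ^ 2 := pow_le_pow_left₀ (by positivity) h1 2
  have h5 : (1 - κ ^ 2 / 2) * ‖v‖ ^ 2 ≤ max (1 - κ ^ 2 / 2) 0 * ‖v‖ ^ 2 := by
    gcongr
    exact le_max_left _ _
  nlinarith

/-- The positive part `(A - m)₊`. -/
def upperPart (A : F →L[ℂ] F) (m : ℝ) : F →L[ℂ] F := cfc (fun s : ℝ => max (s - m) 0) A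

theorem isSelfAdjoint_upperPart (A : F →L[ℂ] F) (m : ℝ) : IsSelfAdjoint (upperPart A m) :=
  cfc_predicate _ _

theorem inner_cfc_nonneg (A : F →L[ℂ] F) (f : ℝ → ℝ) (hf : ∀ s, 0 ≤ f s) (v : F) :
    0 ≤ (⟪cfc f A v, v⟫_ℂ).re := by
  have h : (0 : F →L[ℂ] F) ≤ cfc f A := cfc_nonneg fun s _ => hf s
  exact ((ContinuousLinearMap.nonneg_iff_isPositive _).1 h).re_inner_nonneg_left v

omit [CompleteSpace F] in
theorem re_inner_self (v : F) : (⟪v, v⟫_ℂ).re = ‖v‖ ^ 2 := inner_self_eq_norm_sq (𝕜 := ℂ) v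

/-- The scalar identity `s t = m t + t²` for `t = (s - m)₊`. The range of `upperPart A m` stands in
for the spectral subspace above `m`. -/
theorem apply_upperPart {A : F →L[ℂ] F} (hA : IsSelfAdjoint A) (m : ℝ) (u : F) :
    A (upperPart A m u) = (m : ℂ) • upperPart A m u + upperPart A m (upperPart A m u) := by
  have h : A * upperPart A m = m • upperPart A m + upperPart A m * upperPart A m := by
    have h1 : A * upperPart A m = cfc (fun s : ℝ => s * max (s - m) 0) A := by
      rw [cfc_mul _ _ A, cfc_id' ℝ A hA]; rfl
    rw [h1, upperPart, ← cfc_smul m _ A, ← cfc_mul _ _ A, ← cfc_add A _ _]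
    refine cfc_congr fun s _ => ?_
    rcases le_total (s - m) 0 with h | h
    · simp [max_eq_right h]
    · simp only [max_eq_left h, smul_eq_mul]; ring
  simpa using congrArg (fun S : F →L[ℂ] F => S u) h

theorem upperPart_comm {A : F →L[ℂ] F} (hA : IsSelfAdjoint A) (m : ℝ) (u : F) :
    A (upperPart A m u) = upperPart A m (A u) := by
  have h : Commute A (upperPart A m) := (hA.commute_cfc (Commute.refl A) _).symm
  simpa using congrArg (fun S : F →L[ℂ] F => S u) h.eq

theorem form_ge_of_mem_range_upperPart {A : F →L[ℂ] F} (hA : IsSelfAdjoint A) (m : ℝ) {v : F}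
    (hv : v ∈ LinearMap.range (upperPart A m).toLinearMap) :
    m * ‖v‖ ^ 2 ≤ (⟪A v, v⟫_ℂ).re := by
  obtain ⟨u, rfl⟩ := hv
  simp only [ContinuousLinearMap.coe_coe]
  rw [apply_upperPart hA, inner_add_left, inner_smul_left, Complex.conj_ofReal, Complex.add_re,
    Complex.re_ofReal_mul, re_inner_self]
  have := inner_cfc_nonneg A (fun s : ℝ => max (s - m) 0) (fun s => le_max_right _ _)
    (upperPart A m u)
  have h2 : (⟪upperPart A m (upperPart A m u), upperPart A m u⟫_ℂ).re ≥ 0 := this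
  linarith

/-- From `A + (m - A)₊ = m + (A - m)₊`, where `(m - A)₊ ≥ 0`. -/
theorem form_le_of_upperPart_eq_zero {A : F →L[ℂ] F} (hA : IsSelfAdjoint A) (m : ℝ) {v : F}
    (hv : upperPart A m v = 0) : (⟪A v, v⟫_ℂ).re ≤ m * ‖v‖ ^ 2 := by
  have h : A + cfc (fun s : ℝ => max (m - s) 0) A = m • 1 + upperPart A m := by
    have h1 : A = cfc (fun s : ℝ => s) A := (cfc_id' ℝ A).symm
    have h2 : (m • 1 : F →L[ℂ] F) = cfc (fun _ : ℝ => m) A := by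
      rw [cfc_const m A, Algebra.algebraMap_eq_smul_one]
    rw [h2, upperPart, ← cfc_add A _ _]
    nth_rewrite 1 [h1]
    rw [← cfc_add A _ _]
    refine cfc_congr fun s _ => ?_
    rcases le_total (s - m) 0 with h | h
    · simp only [max_eq_right h, max_eq_left (show 0 ≤ m - s by linarith)]; ring
    · simp only [max_eq_left h, max_eq_right (show m - s ≤ 0 by linarith)]; ring
  have h2 : A v + cfc (fun s : ℝ => max (m - s) 0) A v = (m : ℂ) • v := by
    simpa [hv] using congrArg (fun S : F →L[ℂ] F => S v) h
  have h3 := congrArg (fun w => (⟪w, v⟫_ℂ).re) h2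
  simp only [inner_add_left, inner_smul_left, Complex.conj_ofReal, Complex.add_re,
    Complex.re_ofReal_mul, re_inner_self] at h3
  have := inner_cfc_nonneg A (fun s : ℝ => max (m - s) 0) (fun s => le_max_right _ _) v
  linarith

theorem mem_range_upperPart_of_fixed {A : F →L[ℂ] F} (hA : IsSelfAdjoint A) {m : ℝ} (hm : m < 1)
    {v : F} (hv : A v = v) : v ∈ LinearMap.range (upperPart A m).toLinearMap := by
  -- This is the quotient of `(s - m)₊ - (1 - m)` by `s - 1`, continuous since `m < 1`. It shows
  -- that `upperPart A m` acts on `v` as the scalar `1 - m`.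
  have hcont : Continuous fun s : ℝ => (1 - m) * (1 - min s m)⁻¹ := by
    refine continuous_const.mul (Continuous.inv₀ (by fun_prop) fun s => ?_)
    have := min_le_right s m
    linarith
  set h := cfc (fun s : ℝ => (1 - m) * (1 - min s m)⁻¹) A with hh
  have key : upperPart A m - (1 - m) • 1 = h * (A - 1) := by
    have h2 : ((1 - m) • 1 : F →L[ℂ] F) = cfc (fun _ : ℝ => 1 - m) A := by
      rw [cfc_const _ A, Algebra.algebraMap_eq_smul_one]
    have h3 : A - 1 = cfc (fun s : ℝ => s - 1) A := by
      rw [cfc_sub (fun s : ℝ => s) (fun _ => 1) A, cfc_id' ℝ A, cfc_const_one ℝ A]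
    rw [h2, h3, upperPart, hh, ← cfc_sub _ _ A,
      ← cfc_mul _ _ A hcont.continuousOn (by fun_prop)]
    refine cfc_congr fun s _ => ?_
    rcases le_total (s - m) 0 with h | h
    · have h4 : 1 - s ≠ 0 := by linarith
      simp only [max_eq_right h, min_eq_left (show s ≤ m by linarith)]
      field_simp
      ring
    · have h4 : 1 - m ≠ 0 := by linarith
      simp only [max_eq_left h, min_eq_right (show m ≤ s by linarith)]
      field_simp
      ring
  have h1 : upperPart A m v = ((1 - m : ℝ) : ℂ) • v := by
    have := congrArg (fun S : F →L[ℂ] F => S v) key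
    simp only [sub_apply, smul_apply, one_apply_eq_self,
      mul_apply_eq_comp, hv, sub_self, map_zero, sub_eq_zero] at this
    rw [this, Complex.coe_smul]
  refine ⟨((1 - m : ℝ) : ℂ)⁻¹ • v, ?_⟩
  have h4 : ((1 - m : ℝ) : ℂ) ≠ 0 := by exact_mod_cast (by linarith : (1 - m : ℝ) ≠ 0)
  simp only [ContinuousLinearMap.coe_coe, map_smul, h1, smul_smul, inv_mul_cancel₀ h4, one_smul]

omit [CompleteSpace F] in
theorem form_sub_le (A A' : F →L[ℂ] F) (v : F) :
    |(⟪A' v, v⟫_ℂ).re - (⟪A v, v⟫_ℂ).re| ≤ ‖A' - A‖ * ‖v‖ ^ 2 := by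
  rw [← Complex.sub_re, ← inner_sub_left, ← sub_apply]
  calc _ ≤ ‖⟪(A' - A) v, v⟫_ℂ‖ := Complex.abs_re_le_norm _
    _ ≤ ‖(A' - A) v‖ * ‖v‖ := norm_inner_le_norm _ _
    _ ≤ (‖A' - A‖ * ‖v‖) * ‖v‖ := by gcongr; exact (A' - A).le_opNorm v
    _ = _ := by ring

/-- Two min-max comparisons. On the range the form of `A'` is at least `m`, while off `ker (A - 1)`
that of `A` is at most `c`. Conversely, on `ker (A - 1)` the form of `A` is `1`, while orthogonally
to the range that of `A'` is at most `m`. -/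
theorem finrank_range_upperPart {A A' : F →L[ℂ] F} (hA' : IsSelfAdjoint A') {c m : ℝ}
    [FiniteDimensional ℂ (eigenKer A 1)]
    (hc : ∀ v, (∀ w ∈ eigenKer A 1, ⟪w, v⟫_ℂ = 0) → (⟪A v, v⟫_ℂ).re ≤ c * ‖v‖ ^ 2)
    (h1 : ‖A' - A‖ < m - c) (h2 : ‖A' - A‖ < 1 - m) :
    FiniteDimensional ℂ (LinearMap.range (upperPart A' m).toLinearMap) ∧
      Module.finrank ℂ (LinearMap.range (upperPart A' m).toLinearMap) =
        Module.finrank ℂ (eigenKer A 1) := by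
  have hzero : ∀ v : F, ∀ r : ℝ, 0 < r → r * ‖v‖ ^ 2 ≤ 0 → v = 0 := fun v r hr h => by
    by_contra hne
    have : 0 < ‖v‖ := norm_pos_iff.2 hne
    have : 0 < r * ‖v‖ ^ 2 := by positivity
    linarith
  have hle := finrank_le_of_orthogonal_eq_zero (U := LinearMap.range (upperPart A' m).toLinearMap)
    (N := eigenKer A 1) (fun v hv hort => by
      have h3 := form_ge_of_mem_range_upperPart hA' m hv
      have h4 := hc v hort
      have h5 := (abs_le.1 (form_sub_le A A' v)).2
      exact hzero v (m - c - ‖A' - A‖) (by linarith) (by linarith))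
  have := hle.1
  refine ⟨hle.1, le_antisymm hle.2 (finrank_le_of_orthogonal_eq_zero
    (U := eigenKer A 1) fun v hv hort => ?_).2⟩
  have hk : upperPart A' m v = 0 := by
    rw [← inner_self_eq_zero (𝕜 := ℂ)]
    have h3 := (isSelfAdjoint_upperPart A' m).isSymmetric (upperPart A' m v) v
    have h4 := hort _ ⟨upperPart A' m v, rfl⟩
    exact h3.symm.trans h4
  have h3 := form_le_of_upperPart_eq_zero hA' m hk
  have h5 := (abs_le.1 (form_sub_le A A' v)).1
  have h6 : (⟪A v, v⟫_ℂ).re = ‖v‖ ^ 2 := by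
    rw [mem_eigenKer_one.1 hv, inner_self_eq_norm_sq_to_K]
    norm_cast
  exact hzero v (1 - m - ‖A' - A‖) (by linarith) (by linarith)

/-- `W` commutes with `upperPart A m`, so it acts on the finite-dimensional range `R` with square
`-(1 - A²)`, and the parity lemma applies with `T = 1 - A²`. -/
theorem finrank_fixed_parity_of_antilinear {A : F →L[ℂ] F} (hA : IsSelfAdjoint A)
    (hn : ∀ v, ‖A v‖ ≤ ‖v‖) {m : ℝ} (hm0 : 0 ≤ m) (hm : m < 1)
    [FiniteDimensional ℂ (LinearMap.range (upperPart A m).toLinearMap)]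
    (W : F →L⋆[ℂ] F) (hWA : ∀ v, W (A v) = A (W v)) (hW : ∀ v, W (W v) = -(v - A (A v))) :
    FiniteDimensional ℂ (eigenKer A 1) ∧
    (Module.finrank ℂ (eigenKer A 1) : ZMod 2) =
      (Module.finrank ℂ (LinearMap.range (upperPart A m).toLinearMap) : ZMod 2) := by
  set R := LinearMap.range (upperPart A m).toLinearMap with hR
  have hWk : ∀ v, W (upperPart A m v) = upperPart A m (W v) :=
    antilinear_intertwines_cfc W hA hA hWA _ (by fun_prop)
  have hWR : ∀ v : R, (W.toLinearMap.comp R.subtype) v ∈ R := by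
    rintro ⟨_, v, rfl⟩
    exact ⟨W v, (hWk v).symm⟩
  have hAR : ∀ v ∈ R, A v ∈ R := by
    rintro _ ⟨v, rfl⟩
    exact ⟨A v, (upperPart_comm hA m v).symm⟩
  have hTR : ∀ v ∈ R, (1 - A * A).toLinearMap v ∈ R := fun v hv => by
    simpa using R.sub_mem hv (hAR _ (hAR _ hv))
  have hsymm : ∀ v w, ⟪A v, w⟫_ℂ = ⟪v, A w⟫_ℂ := fun v w => hA.isSymmetric v w
  have hpos : ((1 - A * A).toLinearMap.restrict hTR).IsPositive := by
    constructor
    · rintro ⟨v, hv⟩ ⟨w, hw⟩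
      change ⟪v - A (A v), w⟫_ℂ = ⟪v, w - A (A w)⟫_ℂ
      rw [inner_sub_left, inner_sub_right, hsymm, hsymm]
    · rintro ⟨v, hv⟩
      change 0 ≤ (⟪v - A (A v), v⟫_ℂ).re
      rw [inner_sub_left, hsymm, inner_self_eq_norm_sq_to_K, inner_self_eq_norm_sq_to_K]
      norm_cast
      have := pow_le_pow_left₀ (norm_nonneg _) (hn v) 2
      simp only [Complex.coe_algebraMap]
      norm_cast
      linarith
  have hpar := finrank_eq_finrank_ker_of_antilinear_sq
    (LinearMap.codRestrict R (W.toLinearMap.comp R.subtype) hWR)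
    ((1 - A * A).toLinearMap.restrict hTR) hpos (fun v => Subtype.ext (by
      change W (W v) = -(v - A (A v))
      exact hW v))
  -- If `A² v = v` in `R`, then `w = v - A v` lies in `R` and `A w = -w`. The form of `A` is at
  -- least `m ≥ 0` on `R`, so `w = 0`.
  have hmap : (LinearMap.ker ((1 - A * A).toLinearMap.restrict hTR)).map R.subtype =
      eigenKer A 1 := by
    ext v
    rw [mem_eigenKer_one]
    constructor
    · rintro ⟨⟨v, hv⟩, hker, rfl⟩
      have h1 : v - A (A v) = 0 := congrArg Subtype.val hker
      have h2 : v - A v ∈ R := R.sub_mem hv (hAR v hv)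
      have h3 := form_ge_of_mem_range_upperPart hA m h2
      have h4 : A (v - A v) = -(v - A v) := by
        rw [map_sub, ← sub_eq_zero.1 h1]; abel
      rw [h4, inner_neg_left, inner_self_eq_norm_sq_to_K] at h3
      simp only [Complex.coe_algebraMap] at h3
      norm_cast at h3
      have h5 : ‖v - A v‖ = 0 := by
        have := mul_nonneg hm0 (sq_nonneg ‖v - A v‖)
        have := sq_nonneg ‖v - A v‖
        exact pow_eq_zero_iff two_ne_zero |>.1 (by linarith)
      exact (sub_eq_zero.1 (norm_eq_zero.1 h5)).symm
    · intro hv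
      refine ⟨⟨v, mem_range_upperPart_of_fixed hA hm hv⟩, Subtype.ext ?_, rfl⟩
      change v - A (A v) = 0
      rw [hv, hv, sub_self]
  have hfin : Module.finrank ℂ (eigenKer A 1) =
      Module.finrank ℂ (LinearMap.ker ((1 - A * A).toLinearMap.restrict hTR)) := by
    rw [← hmap]
    exact Submodule.finrank_map_subtype_eq _ _
  refine ⟨?_, by rw [hfin, hpar]⟩
  rw [← hmap]
  infer_instance

/-- The threshold `m = (1 + c) / 2` is midway between `c` and `1`, and `δ` is its distance to both.
Finite dimension for `A'` comes from the finite rank of `upperPart A' m`. -/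
theorem exists_parity_stable {A : F →L[ℂ] F} (hA : IsSelfAdjoint A)
    (hc : IsCompactOperator A) (hn : ∀ v, ‖A v‖ ≤ ‖v‖) :
    ∃ δ : ℝ, 0 < δ ∧ ∀ A' : F →L[ℂ] F, IsSelfAdjoint A' → (∀ v, ‖A' v‖ ≤ ‖v‖) → ‖A' - A‖ < δ →
      ∀ W : F →L⋆[ℂ] F, (∀ v, W (A' v) = A' (W v)) → (∀ v, W (W v) = -(v - A' (A' v))) →
        FiniteDimensional ℂ (eigenKer A' 1) ∧
        (Module.finrank ℂ (eigenKer A' 1) : ZMod 2) =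
          (Module.finrank ℂ (eigenKer A 1) : ZMod 2) := by
  obtain ⟨c, hc0, hc1, hform⟩ := exists_form_bound_of_isCompactOperator hA hc hn
  have := finiteDimensional_eigenKer hc one_ne_zero
  refine ⟨(1 - c) / 2, by linarith, fun A' hA' hn' hd W hWA hW => ?_⟩
  obtain ⟨hfd, hrank⟩ := finrank_range_upperPart (A := A) hA' (c := c) (m := (1 + c) / 2) hform
    (by linarith) (by linarith)
  rw [← hrank]
  exact finrank_fixed_parity_of_antilinear hA' hn' (by linarith) (by linarith) W hWA hW

omit [CompleteSpace F] in
theorem finrank_fixed_eq_zero_of_antilinear {A : F →L[ℂ] F} [FiniteDimensional ℂ (eigenKer A 1)]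
    (W : F →L⋆[ℂ] F) (hWA : ∀ v, W (A v) = A (W v)) (hW : ∀ v, W (W v) = -v) :
    (Module.finrank ℂ (eigenKer A 1) : ZMod 2) = 0 := by
  have hWR : ∀ v : eigenKer A 1, (W.toLinearMap.comp (eigenKer A 1).subtype) v ∈ eigenKer A 1 :=
    fun v => mem_eigenKer_one.2 (by
      change A (W v) = W v
      rw [← hWA, mem_eigenKer_one.1 v.2])
  rw [ZMod.natCast_eq_zero_iff_even]
  refine even_finrank_of_antilinear_sq
    (LinearMap.codRestrict _ (W.toLinearMap.comp (eigenKer A 1).subtype) hWR) LinearMap.id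
    ⟨fun v w => rfl, fun v => ?_⟩ Function.injective_id (fun v => Subtype.ext (hW v))
  exact inner_self_nonneg (𝕜 := ℂ)

end Stability

/-! ### Lattice estimates: Schur test, spectral gap, compact commutators. -/

section Lattice

variable {d M : ℕ}

theorem latticePoint_sub (x y : Site d) : latticePoint (x - y) = latticePoint x - latticePoint y := by
  ext j; simp [latticePoint]

/-- Every finite set of sites lies in a box, over which the sum factorizes. -/
theorem summable_prod_apply {g : ℤ → ℝ} (hg : Summable g) (h0 : ∀ n, 0 ≤ g n) :
    Summable fun z : Site d => ∏ j, g (z j) := by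
  refine summable_of_sum_le (c := (∑' n, g n) ^ d)
    (fun z => Finset.prod_nonneg fun j _ => h0 _) fun s => ?_
  set t : Fin d → Finset ℤ := fun j => s.image fun z => z j with ht
  have hsub : s ⊆ Fintype.piFinset t := fun z hz =>
    Fintype.mem_piFinset.2 fun j => Finset.mem_image.2 ⟨z, hz, rfl⟩
  have hprod : ∏ j, ∑ n ∈ t j, g n = ∑ z ∈ Fintype.piFinset t, ∏ j, g (z j) :=
    Finset.prod_univ_sum t fun _ n => g n
  calc ∑ z ∈ s, ∏ j, g (z j)
      ≤ ∑ z ∈ Fintype.piFinset t, ∏ j, g (z j) :=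
        Finset.sum_le_sum_of_subset_of_nonneg hsub
          fun z _ _ => Finset.prod_nonneg fun j _ => h0 _
    _ = ∏ j, ∑ n ∈ t j, g n := hprod.symm
    _ ≤ ∏ _j : Fin d, ∑' n, g n :=
        Finset.prod_le_prod (fun j _ => Finset.sum_nonneg fun n _ => h0 n)
          fun j _ => hg.sum_le_tsum _ fun n _ => h0 n
    _ = _ := by simp

theorem summable_exp_neg_norm {ξ : ℝ} (hξ : 0 < ξ) :
    Summable fun z : Site d => Real.exp (-‖latticePoint z‖ / ξ) := by
  -- The Euclidean norm dominates `(∑ |z_j|) / (d + 1)`; `d + 1` in place of `d` covers `d = 0`.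
  set c : ℝ := 1 / ((d + 1) * ξ) with hc
  have hc0 : 0 < c := by positivity
  have hint : Summable fun n : ℤ => Real.exp (-(c * |(n : ℝ)|)) := by
    have hnat : Summable fun n : ℕ => Real.exp (-(c * |(n : ℝ)|)) := by
      have := summable_geometric_of_lt_one (Real.exp_pos (-c)).le
        (Real.exp_lt_one_iff.2 (neg_lt_zero.2 hc0))
      refine this.congr fun n => ?_
      rw [← Real.exp_nat_mul, Nat.abs_cast]
      congr 1; ring
    refine Summable.of_nat_of_neg ?_ ?_
    · simpa using hnat
    · simpa using hnat
  refine Summable.of_nonneg_of_le (fun z => (Real.exp_pos _).le) (fun z => ?_)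
    (summable_prod_apply hint fun n => (Real.exp_pos _).le)
  rw [← Real.exp_sum, Real.exp_le_exp, Finset.sum_neg_distrib, neg_div, neg_le_neg_iff,
    ← Finset.mul_sum]
  have h1 : ∑ j, |((z j : ℤ) : ℝ)| ≤ d * ‖latticePoint z‖ := by
    calc ∑ j, |((z j : ℤ) : ℝ)| ≤ ∑ _j : Fin d, ‖latticePoint z‖ :=
          Finset.sum_le_sum fun j _ => PiLp.norm_apply_le (latticePoint z) j
      _ = _ := by simp
  have h2 : 0 ≤ ‖latticePoint z‖ := norm_nonneg _
  calc c * ∑ j, |((z j : ℤ) : ℝ)| ≤ c * ((d + 1) * ‖latticePoint z‖) := by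
        gcongr; linarith
    _ = ‖latticePoint z‖ / ξ := by rw [hc]; field_simp

theorem finite_setOf_norm_le (a : EuclideanSpace ℝ (Fin d)) (ρ : ℝ) :
    {x : Site d | ‖latticePoint x - a‖ ≤ ρ}.Finite := by
  refine (Set.Finite.pi' (t := fun j => Set.Icc ⌊a j - ρ⌋ ⌈a j + ρ⌉)
    fun j => Set.finite_Icc _ _).subset fun x hx j => ?_
  have h1 : |(x j : ℝ) - a j| ≤ ρ := (PiLp.norm_apply_le (latticePoint x - a) j).trans hx
  rw [abs_le] at h1
  refine ⟨Int.cast_le.1 ((Int.floor_le _).trans (?_ : a j - ρ ≤ (x j : ℝ))),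
    Int.cast_le.1 ((?_ : (x j : ℝ) ≤ a j + ρ).trans (Int.le_ceil _))⟩
  · linarith
  · linarith

theorem wave_ext {φ ψ : Wave d M} (h : ∀ x, φ x = ψ x) : φ = ψ := lp.ext (funext h)

/-- The wave function which vanishes off one site. -/
def siteVec (x : Site d) (w : EuclideanSpace ℂ (Fin M)) : Wave d M := lp.single 2 x w

theorem siteVec_apply_self (x : Site d) (w : EuclideanSpace ℂ (Fin M)) : siteVec x w x = w :=
  lp.single_apply_self (E := fun _ : Site d => EuclideanSpace ℂ (Fin M)) 2 x w

theorem siteVec_apply_ne {x y : Site d} (h : x ≠ y) (w : EuclideanSpace ℂ (Fin M)) :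
    siteVec y w x = 0 :=
  lp.single_apply_ne (E := fun _ : Site d => EuclideanSpace ℂ (Fin M)) 2 y w h

theorem add_wave_apply (φ ψ : Wave d M) (x : Site d) : (φ + ψ) x = φ x + ψ x := rfl

theorem sub_wave_apply (φ ψ : Wave d M) (x : Site d) : (φ - ψ) x = φ x - ψ x := rfl

theorem smul_wave_apply (c : ℂ) (φ : Wave d M) (x : Site d) : (c • φ) x = c • φ x := rfl

theorem sum_wave_apply {ι : Type*} (s : Finset ι) (φ : ι → Wave d M) (x : Site d) :
    (∑ i ∈ s, φ i) x = ∑ i ∈ s, φ i x := by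
  rw [lp.coeFn_sum]
  exact Finset.sum_apply x s fun i => (φ i : Site d → EuclideanSpace ℂ (Fin M))

theorem siteProj_apply (x : Site d) (φ : Wave d M) : siteProj M x φ = siteVec x (φ x) := by
  refine wave_ext fun x' => ?_
  rw [siteProj, mulOp_apply]
  by_cases h : x' = x
  · subst h; simp [siteVec_apply_self]
  · simp [h, siteVec_apply_ne h]

theorem norm_apply_le (φ : Wave d M) (x : Site d) : ‖φ x‖ ≤ ‖φ‖ :=
  lp.norm_apply_le_norm two_ne_zero φ x

theorem norm_siteVec (x : Site d) (w : EuclideanSpace ℂ (Fin M)) : ‖siteVec x w‖ = ‖w‖ :=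
  lp.norm_single (E := fun _ : Site d => EuclideanSpace ℂ (Fin M)) two_pos x w

theorem inner_siteVec_left (x : Site d) (w : EuclideanSpace ℂ (Fin M)) (φ : Wave d M) :
    ⟪siteVec x w, φ⟫_ℂ = ⟪w, φ x⟫_ℂ :=
  lp.inner_single_left (G := fun _ : Site d => EuclideanSpace ℂ (Fin M)) (𝕜 := ℂ) x w φ

theorem inner_siteVec_right (x : Site d) (w : EuclideanSpace ℂ (Fin M)) (φ : Wave d M) :
    ⟪φ, siteVec x w⟫_ℂ = ⟪φ x, w⟫_ℂ :=
  lp.inner_single_right (G := fun _ : Site d => EuclideanSpace ℂ (Fin M)) (𝕜 := ℂ) x w φ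

theorem hasSum_siteVec (φ : Wave d M) : HasSum (fun x => siteVec x (φ x)) φ :=
  lp.hasSum_single ENNReal.ofNat_ne_top φ

theorem sum_norm_sq_le (φ : Wave d M) (s : Finset (Site d)) : ∑ x ∈ s, ‖φ x‖ ^ 2 ≤ ‖φ‖ ^ 2 := by
  have := lp.sum_rpow_le_norm_rpow (p := 2) (by norm_num) φ s
  simpa using this

theorem norm_le_of_sum_norm_sq_le {φ : Wave d M} {C : ℝ} (hC : 0 ≤ C)
    (h : ∀ s : Finset (Site d), ∑ x ∈ s, ‖φ x‖ ^ 2 ≤ C ^ 2) : ‖φ‖ ≤ C :=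
  lp.norm_le_of_forall_sum_le (by norm_num) hC (by simpa using h)

theorem norm_apply_single_le {T : Op d M} {x y : Site d} {K : ℝ}
    (h : ‖siteProj M x ∘L T ∘L siteProj M y‖ ≤ K) (w : EuclideanSpace ℂ (Fin M)) :
    ‖T (siteVec y w) x‖ ≤ K * ‖w‖ := by
  have h1 := ContinuousLinearMap.le_of_opNorm_le _ h (siteVec y w)
  simpa [siteProj_apply, norm_siteVec, siteVec_apply_self] using h1

/-- The Schur test for operators whose blocks are bounded by a summable function of the
displacement. -/
theorem norm_apply_le_of_schur {T : Op d M} {k : Site d → ℝ} (hk : Summable k)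
    (hT : ∀ x y, ‖siteProj M x ∘L T ∘L siteProj M y‖ ≤ k (x - y)) (φ : Wave d M) :
    ‖T φ‖ ≤ (∑' z, k z) * ‖φ‖ := by
  have hk0 : ∀ z, 0 ≤ k z := fun z => by
    have := (norm_nonneg _).trans (hT z 0)
    rwa [sub_zero] at this
  have hS0 : 0 ≤ ∑' z, k z := tsum_nonneg hk0
  have hrow : ∀ (x : Site d) (s : Finset (Site d)), ∑ y ∈ s, k (x - y) ≤ ∑' z, k z := fun x s => by
    rw [← (Equiv.subLeft x).tsum_eq k]
    exact ((Equiv.subLeft x).summable_iff.2 hk).sum_le_tsum s fun y _ => hk0 _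
  have hcol : ∀ (y : Site d) (t : Finset (Site d)), ∑ x ∈ t, k (x - y) ≤ ∑' z, k z := fun y t => by
    rw [← (Equiv.subRight y).tsum_eq k]
    exact ((Equiv.subRight y).summable_iff.2 hk).sum_le_tsum t fun x _ => hk0 _
  have hfin : ∀ s : Finset (Site d), ‖T (∑ y ∈ s, siteVec y (φ y))‖ ≤ (∑' z, k z) * ‖φ‖ := by
    intro s
    refine norm_le_of_sum_norm_sq_le (by positivity) fun t => ?_
    have hpt : ∀ x, ‖T (∑ y ∈ s, siteVec y (φ y)) x‖ ^ 2 ≤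
        (∑' z, k z) * ∑ y ∈ s, k (x - y) * ‖φ y‖ ^ 2 := fun x => by
      have h1 : ‖T (∑ y ∈ s, siteVec y (φ y)) x‖ ≤ ∑ y ∈ s, k (x - y) * ‖φ y‖ := by
        rw [map_sum, sum_wave_apply]
        exact norm_sum_le_of_le _ fun y _ => norm_apply_single_le (hT x y) _
      -- Cauchy–Schwarz with respect to the weights `k (x - y)`.
      have h2 : (∑ y ∈ s, k (x - y) * ‖φ y‖) ^ 2 ≤
          (∑ y ∈ s, k (x - y)) * ∑ y ∈ s, k (x - y) * ‖φ y‖ ^ 2 :=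
        Finset.sum_sq_le_sum_mul_sum_of_sq_le_mul s (fun y _ => hk0 _)
          (fun y _ => mul_nonneg (hk0 _) (sq_nonneg _)) fun y _ => (by ring_nf; rfl)
      have h3 : 0 ≤ ∑ y ∈ s, k (x - y) * ‖φ y‖ ^ 2 :=
        Finset.sum_nonneg fun y _ => mul_nonneg (hk0 _) (sq_nonneg _)
      exact (pow_le_pow_left₀ (norm_nonneg _) h1 2).trans
        (h2.trans (mul_le_mul_of_nonneg_right (hrow x s) h3))
    calc ∑ x ∈ t, ‖T (∑ y ∈ s, siteVec y (φ y)) x‖ ^ 2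
        ≤ ∑ x ∈ t, (∑' z, k z) * ∑ y ∈ s, k (x - y) * ‖φ y‖ ^ 2 :=
          Finset.sum_le_sum fun x _ => hpt x
      _ = (∑' z, k z) * ∑ y ∈ s, (∑ x ∈ t, k (x - y)) * ‖φ y‖ ^ 2 := by
          rw [← Finset.mul_sum, Finset.sum_comm]
          simp_rw [Finset.sum_mul]
      _ ≤ (∑' z, k z) * ∑ y ∈ s, (∑' z, k z) * ‖φ y‖ ^ 2 := by
          gcongr with y _
          exact hcol y t
      _ = (∑' z, k z) ^ 2 * ∑ y ∈ s, ‖φ y‖ ^ 2 := by rw [← Finset.mul_sum]; ring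
      _ ≤ (∑' z, k z) ^ 2 * ‖φ‖ ^ 2 := by gcongr; exact sum_norm_sq_le φ s
      _ = _ := by ring
  have hlim := ((T.continuous.norm.tendsto φ).comp (hasSum_siteVec φ))
  exact le_of_tendsto hlim (Filter.Eventually.of_forall hfin)

theorem apply_single_of_hopping {H : Op d M} {t : Site d → Site d → Fin M → Fin M → ℂ}
    (h : ∀ (φ : Wave d M) (x : Site d) (α : Fin M), H φ x α = ∑' y, ∑ β, t x y α β * φ y β)
    (x y : Site d) (w : EuclideanSpace ℂ (Fin M)) (α : Fin M) :
    H (siteVec y w) x α = ∑ β, t x y α β * w β := by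
  rw [h, tsum_eq_single y fun y' hy' => ?_]
  · simp only [siteVec_apply_self]
  · simp [siteVec_apply_ne hy']

/-- A bounded operator is determined by its values on single-site vectors, and there the blocks are
Hermitian. -/
theorem IsTightBinding.isSelfAdjoint {H : Op d M} (hH : IsTightBinding H) : IsSelfAdjoint H := by
  obtain ⟨t, ht, -, -, h⟩ := hH
  have key : ∀ x y (u w : EuclideanSpace ℂ (Fin M)),
      ⟪H (siteVec x u) y, w⟫_ℂ = ⟪u, H (siteVec y w) x⟫_ℂ := fun x y u w => by
    simp only [PiLp.inner_apply, apply_single_of_hopping h, RCLike.inner_apply, map_sum, map_mul,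
      Finset.sum_mul, Finset.mul_sum]
    rw [Finset.sum_comm]
    refine Finset.sum_congr rfl fun β _ => Finset.sum_congr rfl fun α _ => ?_
    rw [← ht]; ring
  rw [ContinuousLinearMap.isSelfAdjoint_iff']
  refine lp.ext_continuousLinearMap (by norm_num) fun y => ?_
  refine ContinuousLinearMap.ext fun w => wave_ext fun x => ext_inner_left ℂ fun u => ?_
  change ⟪u, ContinuousLinearMap.adjoint H (siteVec y w) x⟫_ℂ = ⟪u, H (siteVec y w) x⟫_ℂ
  rw [← inner_siteVec_left, ContinuousLinearMap.adjoint_inner_right, inner_siteVec_right]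
  exact key x y u w

/-- An operator has finite range if its blocks vanish beyond some distance. -/
def HasFiniteRange (H : Op d M) : Prop :=
  ∃ R : ℝ, ∀ x y, R < ‖latticePoint x - latticePoint y‖ → ∀ w, H (siteVec y w) x = 0

theorem IsTightBinding.hasFiniteRange {H : Op d M} (hH : IsTightBinding H) : HasFiniteRange H := by
  obtain ⟨t, -, ⟨R, hR⟩, -, h⟩ := hH
  refine ⟨R, fun x y hxy w => ?_⟩
  ext α
  rw [apply_single_of_hopping h]
  simp [hR x y hxy]

/-- The Schur test bounds the resolvent at `E + iε` by `S` for all `ε > 0`. Applied to `(E + iε - H)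
v`, this gives a lower bound that survives `ε → 0`. -/
theorem FermiLevelAdmissible.exists_gap {H : Op d M} {E : ℝ} (hH : IsSelfAdjoint H)
    (hE : FermiLevelAdmissible H E) :
    ∃ g : ℝ, 0 < g ∧ ∀ v, g * ‖v‖ ≤ ‖(E : ℂ) • v - H v‖ := by
  obtain ⟨C, ξ, hC, hξ, h⟩ := hE
  have hk : Summable fun z : Site d => C * Real.exp (-‖latticePoint z‖ / ξ) :=
    (summable_exp_neg_norm hξ).mul_left C
  set S := ∑' z : Site d, C * Real.exp (-‖latticePoint z‖ / ξ) with hS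
  have hS0 : 0 ≤ S := tsum_nonneg fun z => by positivity
  have hb : ∀ ε : ℝ, 0 < ε → ∀ v, ‖v‖ ≤ S * ‖((E : ℂ) • v - H v) + ((ε : ℂ) * Complex.I) • v‖ := by
    intro ε hε v
    have hunit : IsUnit (algebraMap ℂ (Op d M) ((E : ℂ) + ε * Complex.I) - H) := by
      rw [← spectrum.notMem_iff]
      intro hmem
      have := hH.im_eq_zero_of_mem_spectrum hmem
      simp at this
      exact hε.ne' this
    have h1 := norm_apply_le_of_schur hk (T := resolvent H ((E : ℂ) + ε * Complex.I))
      (fun x y => by rw [latticePoint_sub]; exact h ε hε x y)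
      ((algebraMap ℂ (Op d M) ((E : ℂ) + ε * Complex.I) - H) v)
    have h2 : resolvent H ((E : ℂ) + ε * Complex.I)
        ((algebraMap ℂ (Op d M) ((E : ℂ) + ε * Complex.I) - H) v) = v := by
      have := Ring.inverse_mul_cancel _ hunit
      simpa [resolvent] using congrArg (fun S : Op d M => S v) this
    rw [h2] at h1
    convert h1 using 3
    rw [Algebra.algebraMap_eq_smul_one]
    simp only [sub_apply, smul_apply, one_apply_eq_self]
    module
  refine ⟨(S + 1)⁻¹, by positivity, fun v => ?_⟩
  have hlim : Filter.Tendsto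
      (fun ε : ℝ => S * ‖((E : ℂ) • v - H v) + ((ε : ℂ) * Complex.I) • v‖)
      (nhdsWithin 0 (Set.Ioi 0)) (nhds (S * ‖((E : ℂ) • v - H v) + (((0 : ℝ) : ℂ) * Complex.I) • v‖)) :=
    Filter.Tendsto.mono_left (Continuous.tendsto (by fun_prop) _) nhdsWithin_le_nhds
  have h3 : ‖v‖ ≤ S * ‖(E : ℂ) • v - H v‖ := by
    have := ge_of_tendsto hlim (Filter.eventually_of_mem self_mem_nhdsWithin fun ε hε => hb ε hε v)
    simpa using this
  rw [inv_mul_le_iff₀ (by positivity)]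
  have := norm_nonneg ((E : ℂ) • v - H v)
  linarith

theorem isCompactOperator_siteProj (x : Site d) : IsCompactOperator (siteProj M x) := by
  have h1 : IsCompactOperator
      (lp.singleContinuousLinearMap ℂ (fun _ : Site d => EuclideanSpace ℂ (Fin M)) 2 x) :=
    isCompactOperator_of_locallyCompactSpace_rng _
  have h2 := h1.comp_clm (lp.evalCLM ℂ (fun _ : Site d => EuclideanSpace ℂ (Fin M)) 2 x)
  have h3 : ⇑(siteProj M x) = _ ∘ _ := funext fun φ => siteProj_apply x φ
  exact h3 ▸ h2

/-- The `(x, y)` block of the commutator is `f x - f y` times that of `H`, hence small for `x`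
outside a finite set. Keeping only finitely many rows gives compact approximants in norm. -/
theorem isCompactOperator_commutator_mulOp {H : Op d M} (hH : HasFiniteRange H) {f : Site d → ℝ}
    (hf : ∀ x, |f x| ≤ 1)
    (hvar : ∀ R ε : ℝ, 0 < ε → ∃ s : Finset (Site d), ∀ x, x ∉ s → ∀ y,
      ‖latticePoint x - latticePoint y‖ ≤ R → |f x - f y| ≤ ε) :
    IsCompactOperator (mulOp M f hf * H - H * mulOp M f hf) := by
  obtain ⟨R, hR⟩ := hH
  set X := mulOp M f hf * H - H * mulOp M f hf with hX
  have hXs : ∀ x y w, X (siteVec y w) x = ((f x - f y : ℝ) : ℂ) • H (siteVec y w) x := by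
    intro x y w
    have h1 : mulOp M f hf (siteVec y w) = (f y : ℂ) • siteVec y w := by
      refine wave_ext fun x' => ?_
      rw [mulOp_apply, smul_wave_apply]
      by_cases h : x' = y
      · subst h; rfl
      · rw [siteVec_apply_ne h, smul_zero, smul_zero]
    rw [hX, sub_apply, mul_apply_eq_comp, mul_apply_eq_comp, h1, map_smul,
      sub_wave_apply, mulOp_apply, smul_wave_apply, ← sub_smul]
    push_cast
    rfl
  have hcl : IsClosed {S : Op d M | IsCompactOperator S} := isClosed_setOfPred_isCompactOperator
  change _ ∈ {S : Op d M | IsCompactOperator S}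
  rw [← hcl.closure_eq, Metric.mem_closure_iff]
  intro ε hε
  set B := (finite_setOf_norm_le (0 : EuclideanSpace ℝ (Fin d)) R).toFinset with hB
  -- The remaining blocks have norm at most `η ‖H‖` and occupy `B.card` displacements, so the Schur
  -- bound stays below `ε`.
  set η := ε / (2 * (B.card * ‖H‖ + 1)) with hη
  have hη0 : 0 < η := by positivity
  obtain ⟨s, hs⟩ := hvar R η hη0
  have hcpt : IsCompactOperator ((∑ x ∈ s, siteProj M x) * X : Op d M) := by
    have : ∀ s : Finset (Site d), IsCompactOperator ((∑ x ∈ s, siteProj M x : Op d M)) := by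
      classical
      intro s
      induction s using Finset.induction_on with
      | empty => simpa using isCompactOperator_zero
      | insert x s hx ih =>
        rw [Finset.sum_insert hx]
        exact (isCompactOperator_siteProj x).add ih
    exact (this s).comp_clm X
  refine ⟨_, hcpt, ?_⟩
  have hblock : ∀ x y w, ((X - (∑ x ∈ s, siteProj M x) * X) (siteVec y w)) x =
      if x ∈ s then 0 else X (siteVec y w) x := by
    classical
    intro x y w
    have h1 : ∀ ψ : Wave d M, ((∑ x ∈ s, siteProj M x) ψ) x = if x ∈ s then ψ x else 0 := by
      intro ψ
      rw [sum_apply, sum_wave_apply]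
      simp_rw [siteProj_apply]
      split_ifs with hx
      · rw [Finset.sum_eq_single x (fun x' _ hne => by rw [siteVec_apply_ne hne.symm])
          (fun h => absurd hx h), siteVec_apply_self]
      · exact Finset.sum_eq_zero fun x' hx' => by
          rw [siteVec_apply_ne (by rintro rfl; exact hx hx')]
    rw [sub_apply, mul_apply_eq_comp, sub_wave_apply, h1]
    split_ifs <;> simp
  set k : Site d → ℝ := fun z => if z ∈ B then η * ‖H‖ else 0 with hk
  have hks : HasSum k (∑ z ∈ B, η * ‖H‖) := by
    have h1 : ∀ z ∉ B, k z = 0 := fun z hz => if_neg hz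
    have h2 : HasSum k (∑ z ∈ B, k z) := hasSum_sum_of_ne_finset_zero h1
    rwa [Finset.sum_congr rfl fun z hz => if_pos hz] at h2
  have hbound : ∀ x y, ‖siteProj M x ∘L (X - (∑ x ∈ s, siteProj M x) * X) ∘L siteProj M y‖ ≤
      k (x - y) := by
    intro x y
    have hk0 : 0 ≤ k (x - y) := by
      simp only [hk]; split_ifs <;> positivity
    refine ContinuousLinearMap.opNorm_le_bound _ hk0 fun φ => ?_
    simp only [ContinuousLinearMap.comp_apply]
    rw [siteProj_apply, norm_siteVec, siteProj_apply y, hblock]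
    split_ifs with hx
    · rw [norm_zero]; positivity
    · rw [hXs]
      by_cases hxy : ‖latticePoint x - latticePoint y‖ ≤ R
      · have hmem : x - y ∈ B := by
          simpa [hB, latticePoint_sub] using hxy
        have hkv : k (x - y) = η * ‖H‖ := if_pos hmem
        rw [hkv, norm_smul, Complex.norm_real, Real.norm_eq_abs, mul_assoc]
        gcongr
        · exact hs x hx y hxy
        · refine (norm_apply_le _ x).trans ((H.le_opNorm _).trans ?_)
          rw [norm_siteVec]
          gcongr
          exact norm_apply_le φ y
      · rw [hR x y (not_le.1 hxy), smul_zero, norm_zero]; positivity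
  have hfinal := ContinuousLinearMap.opNorm_le_bound _ (tsum_nonneg fun z => (by simp only [hk]; split_ifs <;> positivity))
    (norm_apply_le_of_schur hks.summable hbound)
  rw [dist_eq_norm]
  refine hfinal.trans_lt ?_
  rw [hks.tsum_eq, Finset.sum_const, nsmul_eq_mul]
  have h6 : η * (2 * (B.card * ‖H‖ + 1)) = ε := by rw [hη]; field_simp
  have h7 : 0 ≤ (B.card : ℝ) * ‖H‖ := by positivity
  nlinarith

theorem abs_unitCoord_sub_le {a : EuclideanSpace ℝ (Fin d)} (ha : ∀ x : Site d, latticePoint x ≠ a)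
    (j : Fin d) (x y : Site d) : |unitCoord a j x - unitCoord a j y| ≤
      2 * ‖latticePoint x - latticePoint y‖ / ‖latticePoint x - a‖ := by
  set p := latticePoint x - a with hp
  set q := latticePoint y - a with hq
  have hpq : latticePoint x - latticePoint y = p - q := by rw [hp, hq]; abel
  have hp0 : 0 < ‖p‖ := norm_pos_iff.2 (sub_ne_zero.2 (ha x))
  have hq0 : 0 < ‖q‖ := norm_pos_iff.2 (sub_ne_zero.2 (ha y))
  -- Arranged so that only the distance from `x` to `a` appears in the denominators of the bound.
  have e : unitCoord a j x - unitCoord a j y =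
      ((p - q) j) / ‖p‖ + (q j / ‖q‖) * ((‖q‖ - ‖p‖) / ‖p‖) := by
    have : (p - q) j = p j - q j := rfl
    rw [unitCoord, unitCoord, ← hp, ← hq, this]
    field_simp
    ring
  rw [e, hpq]
  have h1 : |(p - q) j| ≤ ‖p - q‖ := PiLp.norm_apply_le (p - q) j
  have h2 : |q j / ‖q‖| ≤ 1 := abs_unitCoord_le_one a j y
  have h3 : |‖q‖ - ‖p‖| ≤ ‖p - q‖ := by
    rw [norm_sub_rev p q]; exact abs_norm_sub_norm_le q p
  calc _ ≤ |(p - q) j / ‖p‖| + |(q j / ‖q‖) * ((‖q‖ - ‖p‖) / ‖p‖)| := abs_add_le _ _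
    _ ≤ ‖p - q‖ / ‖p‖ + 1 * (‖p - q‖ / ‖p‖) := by
        rw [abs_mul, abs_div _ ‖p‖, abs_div _ ‖p‖, abs_norm]
        gcongr
    _ = _ := by ring

theorem unitCoord_slowly_varying {a : EuclideanSpace ℝ (Fin d)}
    (ha : ∀ x : Site d, latticePoint x ≠ a) (j : Fin d) (R ε : ℝ) (hε : 0 < ε) :
    ∃ s : Finset (Site d), ∀ x, x ∉ s → ∀ y,
      ‖latticePoint x - latticePoint y‖ ≤ R → |unitCoord a j x - unitCoord a j y| ≤ ε := by
  refine ⟨(finite_setOf_norm_le a (2 * R / ε)).toFinset, fun x hx y hxy => ?_⟩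
  have h1 : 2 * R / ε < ‖latticePoint x - a‖ := by simpa using hx
  have hp0 : 0 < ‖latticePoint x - a‖ := norm_pos_iff.2 (sub_ne_zero.2 (ha x))
  refine (abs_unitCoord_sub_le ha j x y).trans ?_
  rw [div_le_iff₀ hp0]
  rw [div_lt_iff₀ hε] at h1
  linarith

end Lattice

/-! ### Clifford relations and charge conjugation. -/

section GammaMatrices

variable {n : ℕ}

/-- The tensor product of matrices on the factors of `ℂ² ⊗ ⋯ ⊗ ℂ²`. -/
def tensorMat (F : Fin n → Matrix (Fin 2) (Fin 2) ℂ) : Matrix (Spin n) (Spin n) ℂ :=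
  fun μ ν => ∏ k, F k (μ k) (ν k)

theorem gamma_eq_tensorMat (j : Fin (2 * n + 1)) : gamma n j = tensorMat (gammaFactor n j) := rfl

theorem tensorMat_mul (F G : Fin n → Matrix (Fin 2) (Fin 2) ℂ) :
    tensorMat F * tensorMat G = tensorMat fun k => F k * G k := by
  ext μ ν
  simp only [Matrix.mul_apply, tensorMat, ← Finset.prod_mul_distrib]
  have h := Finset.prod_univ_sum (fun _ : Fin n => (Finset.univ : Finset (Fin 2)))
    fun k ρ => F k (μ k) ρ * G k ρ (ν k)
  rw [h, Fintype.piFinset_univ]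

theorem tensorMat_one : tensorMat (fun _ : Fin n => (1 : Matrix (Fin 2) (Fin 2) ℂ)) = 1 := by
  ext μ ν
  simp only [tensorMat, Matrix.one_apply]
  by_cases h : μ = ν
  · simp [h]
  · obtain ⟨k, hk⟩ := Function.ne_iff.1 h
    rw [if_neg h]
    exact Finset.prod_eq_zero (Finset.mem_univ k) (if_neg hk)

theorem tensorMat_smul (s : Fin n → ℂ) (F : Fin n → Matrix (Fin 2) (Fin 2) ℂ) :
    tensorMat (fun k => s k • F k) = (∏ k, s k) • tensorMat F := by
  ext μ ν
  simp [tensorMat, Finset.prod_mul_distrib]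

theorem tensorMat_map_conj (F : Fin n → Matrix (Fin 2) (Fin 2) ℂ) :
    (tensorMat F).map (starRingEnd ℂ) = tensorMat fun k => (F k).map (starRingEnd ℂ) := by
  ext μ ν
  simp [tensorMat, Matrix.map_apply]

theorem tensorMat_conjTranspose (F : Fin n → Matrix (Fin 2) (Fin 2) ℂ) :
    (tensorMat F).conjTranspose = tensorMat fun k => (F k).conjTranspose := by
  ext μ ν
  simp [tensorMat, Matrix.conjTranspose_apply]

theorem pauli₁_mul_self : pauli₁ * pauli₁ = 1 := by
  ext i j; fin_cases i <;> fin_cases j <;> simp [pauli₁]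

theorem pauli₂_mul_self : pauli₂ * pauli₂ = 1 := by
  ext i j; fin_cases i <;> fin_cases j <;> simp [pauli₂]

theorem pauli₃_mul_self : pauli₃ * pauli₃ = 1 := by
  ext i j; fin_cases i <;> fin_cases j <;> simp [pauli₃]

theorem pauli₁_mul_pauli₂ : pauli₁ * pauli₂ = -(pauli₂ * pauli₁) := by
  ext i j; fin_cases i <;> fin_cases j <;> simp [pauli₁, pauli₂]

theorem pauli₁_mul_pauli₃ : pauli₁ * pauli₃ = -(pauli₃ * pauli₁) := by
  ext i j; fin_cases i <;> fin_cases j <;> simp [pauli₁, pauli₃]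

theorem pauli₂_mul_pauli₃ : pauli₂ * pauli₃ = -(pauli₃ * pauli₂) := by
  ext i j; fin_cases i <;> fin_cases j <;> simp [pauli₂, pauli₃]

theorem pauli₁_conjTranspose : pauli₁.conjTranspose = pauli₁ := by
  ext i j; fin_cases i <;> fin_cases j <;> simp [pauli₁]

theorem pauli₂_conjTranspose : pauli₂.conjTranspose = pauli₂ := by
  ext i j; fin_cases i <;> fin_cases j <;> simp [pauli₂]

theorem pauli₃_conjTranspose : pauli₃.conjTranspose = pauli₃ := by
  ext i j; fin_cases i <;> fin_cases j <;> simp [pauli₃]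

theorem pauli₁_map_conj : pauli₁.map (starRingEnd ℂ) = pauli₁ := by
  ext i j; fin_cases i <;> fin_cases j <;> simp [pauli₁]

theorem pauli₂_map_conj : pauli₂.map (starRingEnd ℂ) = -pauli₂ := by
  ext i j; fin_cases i <;> fin_cases j <;> simp [pauli₂]

theorem pauli₃_map_conj : pauli₃.map (starRingEnd ℂ) = pauli₃ := by
  ext i j; fin_cases i <;> fin_cases j <;> simp [pauli₃]

theorem one_map_conj : (1 : Matrix (Fin 2) (Fin 2) ℂ).map (starRingEnd ℂ) = 1 :=
  Matrix.map_one _ (map_zero _) (map_one _)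

theorem gammaFactor_mul_self (j : Fin (2 * n + 1)) (k : Fin n) :
    gammaFactor n j k * gammaFactor n j k = 1 := by
  unfold gammaFactor
  split_ifs
  · exact pauli₃_mul_self
  · exact one_mul 1
  · exact pauli₁_mul_self
  · exact pauli₂_mul_self
  · exact pauli₃_mul_self

theorem gamma_mul_self (j : Fin (2 * n + 1)) : gamma n j * gamma n j = 1 := by
  rw [gamma_eq_tensorMat, tensorMat_mul, ← tensorMat_one]
  congr 1
  funext k
  exact gammaFactor_mul_self j k

theorem gamma_conjTranspose (j : Fin (2 * n + 1)) : (gamma n j).conjTranspose = gamma n j := by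
  rw [gamma_eq_tensorMat, tensorMat_conjTranspose]
  congr 1
  funext k
  unfold gammaFactor
  split_ifs
  · exact pauli₃_conjTranspose
  · exact Matrix.conjTranspose_one
  · exact pauli₁_conjTranspose
  · exact pauli₂_conjTranspose
  · exact pauli₃_conjTranspose

theorem gamma_anticomm_of_lt {i j : Fin (2 * n + 1)} (hij : i < j) :
    gamma n i * gamma n j = -(gamma n j * gamma n i) := by
  have hi : i.val < 2 * n := by have := j.isLt; have : i.val < j.val := hij; omega
  have hlt : i.val < j.val := hij
  -- `p` is the only tensor position at which the two factors anticommute; at all others they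
  -- commute.
  obtain ⟨p, hp, hp2⟩ : ∃ p : Fin n, (j.val = 2 * n → p.val = i.val / 2) ∧
      (j.val ≠ 2 * n → p.val = j.val / 2) := by
    by_cases hj : j.val = 2 * n
    · exact ⟨⟨i.val / 2, by omega⟩, fun _ => rfl, fun h => absurd hj h⟩
    · exact ⟨⟨j.val / 2, by omega⟩, fun h => absurd h hj, fun _ => rfl⟩
  have hfac : ∀ k, gammaFactor n i k * gammaFactor n j k =
      (if k = p then (-1 : ℂ) else 1) • (gammaFactor n j k * gammaFactor n i k) := by
    intro k
    have hkp : k = p ↔ k.val = p.val := Fin.ext_iff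
    simp only [hkp]
    unfold gammaFactor
    rw [if_neg hi.ne]
    by_cases hj : j.val = 2 * n
    · rw [if_pos hj, hp hj]
      split_ifs <;> first
        | omega
        | simp [pauli₁_mul_pauli₃, pauli₂_mul_pauli₃]
    · rw [if_neg hj, hp2 hj]
      split_ifs <;> first
        | omega
        | simp [pauli₁_mul_pauli₃, pauli₂_mul_pauli₃, pauli₁_mul_pauli₂]
  rw [gamma_eq_tensorMat, gamma_eq_tensorMat, tensorMat_mul, tensorMat_mul]
  simp_rw [hfac]
  rw [tensorMat_smul]
  simp

theorem gamma_anticomm {i j : Fin (2 * n + 1)} (hij : i ≠ j) :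
    gamma n i * gamma n j = -(gamma n j * gamma n i) := by
  rcases lt_or_gt_of_ne hij with h | h
  · exact gamma_anticomm_of_lt h
  · rw [gamma_anticomm_of_lt h, neg_neg]

theorem gamma_sum_mul_self (u : Fin (2 * n + 1) → ℂ) :
    (∑ j, u j • gamma n j) * ∑ j, u j • gamma n j = (∑ j, u j ^ 2) • 1 := by
  have h1 : ∀ i j, gamma n i * gamma n j + gamma n j * gamma n i =
      if i = j then (2 : ℂ) • 1 else 0 := by
    intro i j
    split_ifs with h
    · subst h; rw [gamma_mul_self, two_smul]
    · rw [gamma_anticomm h, neg_add_cancel]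
  set X := (∑ j, u j • gamma n j) * ∑ j, u j • gamma n j with hX
  have hX1 : X = ∑ i, ∑ j, (u i * u j) • (gamma n i * gamma n j) := by
    rw [hX, Finset.sum_mul]
    refine Finset.sum_congr rfl fun i _ => ?_
    rw [Finset.mul_sum]
    refine Finset.sum_congr rfl fun j _ => ?_
    rw [smul_mul_smul_comm]
  have hX2 : X = ∑ i, ∑ j, (u i * u j) • (gamma n j * gamma n i) := by
    rw [hX1, Finset.sum_comm]
    simp_rw [mul_comm (u _) (u _)]
  have h2 : (2 : ℂ) • X = (2 : ℂ) • (∑ j, u j ^ 2) • 1 := by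
    rw [two_smul]
    nth_rewrite 1 [hX1]
    rw [hX2, ← Finset.sum_add_distrib]
    simp_rw [← Finset.sum_add_distrib, ← smul_add, h1, smul_ite, smul_zero]
    simp only [Finset.sum_ite_eq, Finset.mem_univ, if_true]
    rw [Finset.sum_smul, Finset.smul_sum]
    exact Finset.sum_congr rfl fun j _ => by rw [smul_comm, sq]
  exact smul_right_injective _ two_ne_zero h2

/-- The charge conjugation matrix in dimension `2n+1`. -/
def chargeMat (n : ℕ) : Matrix (Spin n) (Spin n) ℂ :=
  tensorMat fun k => if k.val % 2 = 0 then pauli₂ else pauli₁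

/-- The sign `C C̄` of the charge conjugation. -/
def chargeSign (n : ℕ) : ℂ := ∏ k ∈ Finset.range n, if k % 2 = 0 then (-1 : ℂ) else 1

/-- Each of the `⌈n / 2⌉` factors `σ₂` contributes `-1`. -/
theorem chargeSign_eq (n : ℕ) :
    chargeSign n = if n % 4 = 0 ∨ n % 4 = 3 then 1 else -1 := by
  induction n with
  | zero => simp [chargeSign]
  | succ n ih =>
    have h : chargeSign (n + 1) = chargeSign n * if n % 2 = 0 then (-1 : ℂ) else 1 :=
      Finset.prod_range_succ _ _
    rw [h, ih]
    split_ifs <;> first | omega | norm_num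

theorem chargeMat_mul_conj (n : ℕ) :
    chargeMat n * (chargeMat n).map (starRingEnd ℂ) = chargeSign n • 1 := by
  have hfac : ∀ k : Fin n, (if k.val % 2 = 0 then pauli₂ else pauli₁) *
      (if k.val % 2 = 0 then pauli₂ else pauli₁).map (starRingEnd ℂ) =
      (if k.val % 2 = 0 then (-1 : ℂ) else 1) • (1 : Matrix (Fin 2) (Fin 2) ℂ) := by
    intro k
    split_ifs
    · rw [pauli₂_map_conj, mul_neg, pauli₂_mul_self, neg_one_smul]
    · rw [pauli₁_map_conj, pauli₁_mul_self, one_smul]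
  rw [chargeMat, tensorMat_map_conj, tensorMat_mul]
  simp_rw [hfac]
  rw [tensorMat_smul, tensorMat_one, chargeSign,
    Fin.prod_univ_eq_prod_range fun k => if k % 2 = 0 then (-1 : ℂ) else 1]

theorem prod_range_chargeFactor (p m : ℕ) :
    (∏ k ∈ Finset.range m, if k < p then (1 : ℂ) else if k = p then (-1) ^ (p + 1) else -1) =
      if m ≤ p then 1 else (-1) ^ m := by
  induction m with
  | zero => simp
  | succ m ih =>
    rw [Finset.prod_range_succ, ih]
    split_ifs <;> first | omega | (subst_vars; simp [pow_succ])

/-- The alternation of `σ₂` and `σ₁` makes the sign independent of `j`. With `p = j / 2`, the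
factors contribute `1` before `p`, `(-1)^(p + 1)` at `p`, and `-1` after it: in all `(-1)^n`. For
the last gamma matrix every factor contributes `-1`. -/
theorem chargeMat_mul_gamma_conj (j : Fin (2 * n + 1)) :
    chargeMat n * (gamma n j).map (starRingEnd ℂ) =
      ((-1 : ℂ) ^ n • gamma n j) * chargeMat n := by
  have h13 := pauli₁_mul_pauli₃
  have h23 := pauli₂_mul_pauli₃
  have h12 := pauli₁_mul_pauli₂
  rw [smul_mul_assoc, gamma_eq_tensorMat, chargeMat, tensorMat_map_conj, tensorMat_mul,
    tensorMat_mul]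
  by_cases hj : j.val = 2 * n
  · have hfac : ∀ k : Fin n, (if k.val % 2 = 0 then pauli₂ else pauli₁) *
        (gammaFactor n j k).map (starRingEnd ℂ) =
        (-1 : ℂ) • (gammaFactor n j k * if k.val % 2 = 0 then pauli₂ else pauli₁) := by
      intro k
      unfold gammaFactor
      rw [if_pos hj, pauli₃_map_conj]
      split_ifs <;> simp [h13, h23]
    simp_rw [hfac]
    rw [tensorMat_smul]
    simp
  · have hfac : ∀ k : Fin n, (if k.val % 2 = 0 then pauli₂ else pauli₁) *
        (gammaFactor n j k).map (starRingEnd ℂ) =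
        (if k.val < j.val / 2 then (1 : ℂ) else if k.val = j.val / 2 then
          (-1) ^ (j.val / 2 + 1) else -1) •
        (gammaFactor n j k * if k.val % 2 = 0 then pauli₂ else pauli₁) := by
      intro k
      unfold gammaFactor
      rw [if_neg hj]
      by_cases h1 : k.val < j.val / 2
      · simp only [if_pos h1, one_map_conj, mul_one, one_mul, one_smul]
      · simp only [if_neg h1]
        by_cases h2 : k.val = j.val / 2
        · simp only [← h2]
          by_cases h3 : k.val % 2 = 0
          · have h4 : (-1 : ℂ) ^ (k.val + 1) = -1 := Odd.neg_one_pow (by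
              rw [Nat.odd_iff]; omega)
            rw [h4]
            split_ifs <;> simp [pauli₁_map_conj, pauli₂_map_conj, h12]
          · have h4 : (-1 : ℂ) ^ (k.val + 1) = 1 := Even.neg_one_pow (by
              rw [Nat.even_iff]; omega)
            rw [h4]
            simp only [if_neg h3]
            split_ifs <;> simp [pauli₁_map_conj, pauli₂_map_conj, h12]
        · simp only [if_neg h2, pauli₃_map_conj]
          split_ifs <;> simp [h13, h23]
    simp_rw [hfac]
    rw [tensorMat_smul, Fin.prod_univ_eq_prod_range fun k => if k < j.val / 2 then (1 : ℂ) else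
      if k = j.val / 2 then (-1) ^ (j.val / 2 + 1) else -1, prod_range_chargeFactor,
      if_neg (by have := j.isLt; omega)]

end GammaMatrices

/-! ### Operators on the spinor space and the identity `D² = 1`. -/

section TensorOperators

variable {n M : ℕ}

theorem tensorOp_apply (T : Op (2 * n + 1) M) (G : Matrix (Spin n) (Spin n) ℂ)
    (φ : SpinWave n M) (μ : Spin n) : tensorOp T G φ μ = ∑ ν, G μ ν • T (φ ν) := by
  simp [tensorOp]

theorem tensorOp_mul (T T' : Op (2 * n + 1) M) (G G' : Matrix (Spin n) (Spin n) ℂ) :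
    tensorOp T G * tensorOp T' G' = tensorOp (T * T') (G * G') := by
  ext1 φ
  refine PiLp.ext fun μ => ?_
  simp only [mul_apply_eq_comp, tensorOp_apply, map_sum, map_smul, Finset.smul_sum, smul_smul,
    Matrix.mul_apply, Finset.sum_smul]
  exact Finset.sum_comm

theorem tensorOp_one_apply (T : Op (2 * n + 1) M) (φ : SpinWave n M) (μ : Spin n) :
    tensorOp T 1 φ μ = T (φ μ) := by
  rw [tensorOp_apply, Finset.sum_eq_single μ]
  · simp
  · intro ν _ h
    simp [Matrix.one_apply_ne h.symm]
  · simp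

theorem tensorOp_one_one : tensorOp (1 : Op (2 * n + 1) M) 1 = 1 := by
  ext1 φ
  refine PiLp.ext fun μ => ?_
  rw [tensorOp_one_apply]
  rfl

theorem tensorOp_sub (T T' : Op (2 * n + 1) M) (G : Matrix (Spin n) (Spin n) ℂ) :
    tensorOp (T - T') G = tensorOp T G - tensorOp T' G := by
  ext1 φ
  refine PiLp.ext fun μ => ?_
  simp [tensorOp_apply, smul_sub]

theorem tensorOp_smul (c : ℂ) (T : Op (2 * n + 1) M) (G : Matrix (Spin n) (Spin n) ℂ) :
    tensorOp T (c • G) = c • tensorOp T G := by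
  ext1 φ
  refine PiLp.ext fun μ => ?_
  simp [tensorOp_apply, smul_smul, Finset.smul_sum]

theorem isSelfAdjoint_tensorOp {T : Op (2 * n + 1) M} (hT : IsSelfAdjoint T)
    {G : Matrix (Spin n) (Spin n) ℂ} (hG : G.conjTranspose = G) : IsSelfAdjoint (tensorOp T G) := by
  rw [ContinuousLinearMap.isSelfAdjoint_iff_isSymmetric]
  intro φ ψ
  have hs : ∀ u v, ⟪T u, v⟫_ℂ = ⟪u, T v⟫_ℂ := fun u v => hT.isSymmetric u v
  have hG' : ∀ μ ν, conj (G μ ν) = G ν μ := fun μ ν => by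
    conv_rhs => rw [← hG]
    rfl
  simp only [ContinuousLinearMap.coe_coe, PiLp.inner_apply, tensorOp_apply, sum_inner, inner_sum,
    inner_smul_left, inner_smul_right, hs, hG']
  exact Finset.sum_comm

theorem norm_tensorOp_one_le (T : Op (2 * n + 1) M) : ‖tensorOp (n := n) T 1‖ ≤ ‖T‖ := by
  refine ContinuousLinearMap.opNorm_le_bound _ (norm_nonneg _) fun φ => ?_
  refine le_of_sq_le_sq ?_ (by positivity)
  rw [mul_pow, PiLp.norm_sq_eq_of_L2, PiLp.norm_sq_eq_of_L2, Finset.mul_sum]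
  refine Finset.sum_le_sum fun μ _ => ?_
  rw [tensorOp_one_apply, ← mul_pow]
  exact pow_le_pow_left₀ (norm_nonneg _) (T.le_opNorm _) 2

theorem isCompactOperator_pi {ι E : Type*} [Finite ι] [NormedAddCommGroup E] {F : ι → Type*}
    [∀ i, NormedAddCommGroup (F i)] {f : ∀ i, E → F i} (h : ∀ i, IsCompactOperator (f i)) :
    IsCompactOperator fun v i => f i v := by
  choose K hK hK' using h
  refine ⟨Set.univ.pi K, isCompact_univ_pi hK, ?_⟩
  have : (fun v i => f i v) ⁻¹' Set.univ.pi K = ⋂ i, f i ⁻¹' K i := by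
    ext v; simp
  rw [this]
  exact Filter.iInter_mem.2 hK'

theorem isCompactOperator_tensorOp {T : Op (2 * n + 1) M} (hT : IsCompactOperator T)
    (G : Matrix (Spin n) (Spin n) ℂ) : IsCompactOperator (tensorOp T G) := by
  have h1 : ∀ μ : Spin n, IsCompactOperator fun φ : SpinWave n M => ∑ ν, G μ ν • T (φ ν) := by
    intro μ
    have hsum : ∀ s : Finset (Spin n),
        IsCompactOperator fun φ : SpinWave n M => ∑ ν ∈ s, G μ ν • T (φ ν) := by
      intro s
      induction s using Finset.induction_on with
      | empty =>
        simp only [Finset.sum_empty]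
        exact isCompactOperator_zero
      | insert ν s hν ih =>
        simp_rw [Finset.sum_insert hν]
        exact ((hT.comp_clm (PiLp.proj (𝕜 := ℂ) 2
          (fun _ : Spin n => Wave (2 * n + 1) M) ν)).smul (G μ ν)).add ih
    exact hsum Finset.univ
  have h2 := (isCompactOperator_pi h1).clm_comp
    ((PiLp.continuousLinearEquiv 2 ℂ (fun _ : Spin n => Wave (2 * n + 1) M)).symm :
      (Spin n → Wave (2 * n + 1) M) →L[ℂ] SpinWave n M)
  refine cast (congrArg IsCompactOperator (funext fun φ => PiLp.ext fun μ => ?_)) h2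
  exact (tensorOp_apply T G φ μ).symm

theorem isSelfAdjoint_mulOp {d : ℕ} (f : Site d → ℝ) (hf : ∀ x, |f x| ≤ 1) :
    IsSelfAdjoint (mulOp M f hf) := by
  rw [ContinuousLinearMap.isSelfAdjoint_iff_isSymmetric]
  intro φ ψ
  change ⟪mulOp M f hf φ, ψ⟫_ℂ = ⟪φ, mulOp M f hf ψ⟫_ℂ
  rw [lp.inner_eq_tsum, lp.inner_eq_tsum]
  refine tsum_congr fun x => ?_
  rw [mulOp_apply, mulOp_apply, inner_smul_left, inner_smul_right, Complex.conj_ofReal]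

theorem isSelfAdjoint_sum_operator {ι F : Type*} [NormedAddCommGroup F] [InnerProductSpace ℂ F]
    [CompleteSpace F] (s : Finset ι) (T : ι → F →L[ℂ] F) (h : ∀ i, IsSelfAdjoint (T i)) :
    IsSelfAdjoint (∑ i ∈ s, T i) :=
  isSelfAdjoint_sum s fun i _ => h i

theorem isSelfAdjoint_dirac (a : EuclideanSpace ℝ (Fin (2 * n + 1))) :
    IsSelfAdjoint (dirac n M a) := by
  have h := fun j => isSelfAdjoint_tensorOp
    (isSelfAdjoint_mulOp (M := M) (unitCoord a j) (abs_unitCoord_le_one a j))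
    (gamma_conjTranspose j)
  rw [dirac]
  exact isSelfAdjoint_sum_operator Finset.univ _ fun j => h j

theorem dirac_apply (a : EuclideanSpace ℝ (Fin (2 * n + 1))) (φ : SpinWave n M) (μ : Spin n)
    (x : Site (2 * n + 1)) : dirac n M a φ μ x =
      ∑ ν, (∑ j, (unitCoord a j x : ℂ) • gamma n j) μ ν • φ ν x := by
  have h1 : dirac n M a φ μ = ∑ j, ∑ ν, gamma n j μ ν •
      mulOp M (unitCoord a j) (abs_unitCoord_le_one a j) (φ ν) := by
    rw [dirac, sum_apply, WithLp.ofLp_sum, Finset.sum_apply]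
    simp_rw [tensorOp_apply]
  rw [h1]
  simp only [sum_wave_apply, smul_wave_apply, mulOp_apply, Matrix.sum_apply, Matrix.smul_apply,
    Finset.sum_smul, smul_smul, smul_eq_mul]
  rw [Finset.sum_comm]
  simp_rw [mul_comm]

theorem dirac_mul_self {a : EuclideanSpace ℝ (Fin (2 * n + 1))}
    (ha : ∀ x : Site (2 * n + 1), latticePoint x ≠ a) : dirac n M a * dirac n M a = 1 := by
  ext1 φ
  refine PiLp.ext fun μ => wave_ext fun x => ?_
  have hsum : ∑ j, (unitCoord a j x : ℂ) ^ 2 = 1 := by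
    have h0 : ‖latticePoint x - a‖ ≠ 0 := norm_ne_zero_iff.2 (sub_ne_zero.2 (ha x))
    have h1 : ∑ j, unitCoord a j x ^ 2 = 1 := by
      simp_rw [unitCoord, div_pow]
      rw [← Finset.sum_div, div_eq_one_iff_eq (pow_ne_zero 2 h0), EuclideanSpace.norm_sq_eq]
      simp
    exact_mod_cast h1
  have hG := gamma_sum_mul_self (n := n) fun j => (unitCoord a j x : ℂ)
  rw [hsum, one_smul] at hG
  rw [mul_apply_eq_comp, dirac_apply]
  simp_rw [dirac_apply, Finset.smul_sum, smul_smul]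
  rw [Finset.sum_comm]
  simp_rw [← Finset.sum_smul, ← Matrix.mul_apply]
  rw [hG, Finset.sum_eq_single μ]
  · simp
  · intro ν _ h
    simp [Matrix.one_apply_ne h.symm]
  · simp

end TensorOperators

/-! ### The antiunitary symmetry on spinors. -/

section Antiunitary

variable {d n M : ℕ}

theorem norm_antiunitary_apply_le (U : Matrix.unitaryGroup (Fin M) ℂ) (φ : Wave d M) :
    ‖antiunitary U φ‖ ≤
      ‖Matrix.toEuclideanCLM (𝕜 := ℂ) (U : Matrix (Fin M) (Fin M) ℂ)‖ * ‖φ‖ := by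
  set K := ‖Matrix.toEuclideanCLM (𝕜 := ℂ) (U : Matrix (Fin M) (Fin M) ℂ)‖ with hK
  refine norm_le_of_sum_norm_sq_le (by positivity) fun s => ?_
  have h1 : ∀ x, ‖antiunitary U φ x‖ ≤ K * ‖φ x‖ := fun x => by
    have h := (Matrix.toEuclideanCLM (𝕜 := ℂ) (U : Matrix (Fin M) (Fin M) ℂ)).le_opNorm
      (WithLp.toLp 2 (fun α => conj (φ x α)))
    have h2 : ‖(WithLp.toLp 2 (fun α => conj (φ x α)) : EuclideanSpace ℂ (Fin M))‖ = ‖φ x‖ := by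
      simp [EuclideanSpace.norm_eq]
    rwa [h2, Matrix.toEuclideanCLM_toLp] at h
  calc ∑ x ∈ s, ‖antiunitary U φ x‖ ^ 2 ≤ ∑ x ∈ s, K ^ 2 * ‖φ x‖ ^ 2 := by
        refine Finset.sum_le_sum fun x _ => ?_
        rw [← mul_pow]
        exact pow_le_pow_left₀ (norm_nonneg _) (h1 x) 2
    _ ≤ (K * ‖φ‖) ^ 2 := by
        rw [← Finset.mul_sum, mul_pow]
        gcongr
        exact sum_norm_sq_le φ s

theorem antiunitary_apply (U : Matrix.unitaryGroup (Fin M) ℂ) (φ : Wave d M) (x : Site d) :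
    antiunitary U φ x =
      WithLp.toLp 2 ((U : Matrix (Fin M) (Fin M) ℂ).mulVec fun α => conj (φ x α)) := rfl

/-- The antiunitary transformation `φ ↦ U φ̄` as a continuous antilinear map. -/
def antiunitaryCLM (U : Matrix.unitaryGroup (Fin M) ℂ) : Wave d M →L⋆[ℂ] Wave d M :=
  LinearMap.mkContinuous
    { toFun := antiunitary U
      map_add' := fun φ ψ => wave_ext fun x => by
        rw [add_wave_apply, antiunitary_apply, antiunitary_apply, antiunitary_apply,
          ← WithLp.toLp_add, ← Matrix.mulVec_add]
        congr 2
        funext α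
        simp [add_wave_apply]
      map_smul' := fun c φ => wave_ext fun x => by
        rw [smul_wave_apply, antiunitary_apply, antiunitary_apply,
          ← WithLp.toLp_smul, ← Matrix.mulVec_smul]
        congr 2
        funext α
        simp [smul_wave_apply] }
    _ (norm_antiunitary_apply_le U)

theorem antiunitaryCLM_apply (U : Matrix.unitaryGroup (Fin M) ℂ) (φ : Wave d M) :
    antiunitaryCLM U φ = antiunitary U φ := rfl

theorem antiunitary_mulOp (U : Matrix.unitaryGroup (Fin M) ℂ) (f : Site d → ℝ)
    (hf : ∀ x, |f x| ≤ 1) (φ : Wave d M) :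
    antiunitaryCLM U (mulOp M f hf φ) = mulOp M f hf (antiunitaryCLM U φ) :=
  wave_ext fun x => by
    rw [mulOp_apply, antiunitaryCLM_apply, antiunitaryCLM_apply, antiunitary_apply,
      antiunitary_apply, ← WithLp.toLp_smul, ← Matrix.mulVec_smul]
    congr 2
    funext α
    simp [mulOp_apply]

/-- The antilinear transformation `Θ ⊗ C K` on `ℓ²(ℤ^{2n+1}, ℂ^M) ⊗ ℂ^{2^n}`, with the complex
conjugation `K` and the charge conjugation matrix `C`. -/
def spinAntiunitary (n : ℕ) (U : Matrix.unitaryGroup (Fin M) ℂ) :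
    SpinWave n M →L⋆[ℂ] SpinWave n M where
  toFun φ := WithLp.toLp 2 fun μ => ∑ ν, chargeMat n μ ν • antiunitaryCLM U (φ ν)
  map_add' φ ψ := PiLp.ext fun μ => by
    simp [smul_add, Finset.sum_add_distrib]
  map_smul' c φ := PiLp.ext fun μ => by
    simp [Finset.smul_sum, smul_smul, mul_comm]
  cont := (PiLp.continuous_toLp 2 _).comp (continuous_pi fun μ =>
    continuous_finsetSum _ fun ν _ => by
      have h : Continuous fun φ : SpinWave n M => antiunitaryCLM U (φ ν) :=
        (antiunitaryCLM U).continuous.comp (PiLp.continuous_apply 2 _ ν)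
      exact h.const_smul (chargeMat n μ ν))

theorem spinAntiunitary_apply (U : Matrix.unitaryGroup (Fin M) ℂ) (φ : SpinWave n M)
    (μ : Spin n) : spinAntiunitary n U φ μ = ∑ ν, chargeMat n μ ν • antiunitaryCLM U (φ ν) := rfl

theorem spinAntiunitary_tensorOp (U : Matrix.unitaryGroup (Fin M) ℂ) {T T' : Op (2 * n + 1) M}
    (hT : ∀ φ, antiunitaryCLM U (T φ) = T' (antiunitaryCLM U φ))
    {G G' : Matrix (Spin n) (Spin n) ℂ}
    (hG : chargeMat n * G.map (starRingEnd ℂ) = G' * chargeMat n) (φ : SpinWave n M) :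
    spinAntiunitary n U (tensorOp T G φ) = tensorOp T' G' (spinAntiunitary n U φ) := by
  refine PiLp.ext fun μ => ?_
  simp only [tensorOp_apply, spinAntiunitary_apply, map_sum, map_smul, Finset.smul_sum, smul_smul,
    ContinuousLinearMap.map_smulₛₗ, hT]
  rw [Finset.sum_comm]
  conv_rhs => rw [Finset.sum_comm]
  refine Finset.sum_congr rfl fun ρ _ => ?_
  rw [← Finset.sum_smul, ← Finset.sum_smul]
  congr 1
  have := congrFun (congrFun hG μ) ρ
  simpa [Matrix.mul_apply] using this

theorem spinAntiunitary_spinAntiunitary (U : Matrix.unitaryGroup (Fin M) ℂ) {τ : ℂ}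
    (hU : ∀ φ : Wave (2 * n + 1) M, antiunitary U (antiunitary U φ) = τ • φ) (φ : SpinWave n M) :
    spinAntiunitary n U (spinAntiunitary n U φ) = (chargeSign n * τ) • φ := by
  have hU' : ∀ φ : Wave (2 * n + 1) M, antiunitaryCLM U (antiunitaryCLM U φ) = τ • φ := hU
  refine PiLp.ext fun μ => ?_
  simp only [spinAntiunitary_apply, map_sum, Finset.smul_sum, smul_smul,
    ContinuousLinearMap.map_smulₛₗ, hU']
  rw [Finset.sum_comm]
  have h1 : ∀ ρ, ∑ ν, (chargeMat n μ ν * (conj (chargeMat n ν ρ) * τ)) • φ ρ =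
      ((chargeSign n • (1 : Matrix (Spin n) (Spin n) ℂ)) μ ρ * τ) • φ ρ := fun ρ => by
    rw [← Finset.sum_smul, ← chargeMat_mul_conj, Matrix.mul_apply, Finset.sum_mul]
    simp [mul_assoc]
  simp only [← mul_assoc] at h1 ⊢
  rw [Finset.sum_congr rfl fun ρ _ => h1 ρ, Finset.sum_eq_single μ]
  · simp
  · intro ν _ h
    simp [Matrix.one_apply_ne h.symm]
  · simp

theorem spinAntiunitary_tensorOp_one (U : Matrix.unitaryGroup (Fin M) ℂ) {T T' : Op (2 * n + 1) M}
    (hT : ∀ φ, antiunitaryCLM U (T φ) = T' (antiunitaryCLM U φ)) (φ : SpinWave n M) :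
    spinAntiunitary n U (tensorOp T 1 φ) = tensorOp T' 1 (spinAntiunitary n U φ) :=
  spinAntiunitary_tensorOp U hT
    (by rw [Matrix.map_one _ (map_zero _) (map_one _), mul_one, one_mul]) φ

/-- The coordinate functions are real and commute with `Θ`, so the sign comes from the gamma
matrices alone. -/
theorem spinAntiunitary_dirac (U : Matrix.unitaryGroup (Fin M) ℂ)
    (a : EuclideanSpace ℝ (Fin (2 * n + 1))) (φ : SpinWave n M) :
    spinAntiunitary n U (dirac n M a φ) = (-1 : ℂ) ^ n • dirac n M a (spinAntiunitary n U φ) := by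
  rw [dirac, sum_apply, sum_apply, map_sum, Finset.smul_sum]
  refine Finset.sum_congr rfl fun j _ => ?_
  rw [spinAntiunitary_tensorOp U (antiunitary_mulOp U _ _) (chargeMat_mul_gamma_conj j),
    tensorOp_smul]
  rfl

end Antiunitary

/-! ### Algebra of the pair of projections `P` and `DPD`. -/

section ProjectionPair

variable {F : Type*} [NormedAddCommGroup F] [InnerProductSpace ℂ F]

/-- The difference `P - DPD` of a projection and its conjugate by a symmetry. -/
def pairDiff (D P : F →L[ℂ] F) : F →L[ℂ] F := P - D * (P * D)

/-- The operator `1 - P - DPD`. -/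
def pairSum (D P : F →L[ℂ] F) : F →L[ℂ] F := 1 - P - D * (P * D)

theorem pairDiff_mul_dirac {D P : F →L[ℂ] F} (hD : D * D = 1) :
    D * pairDiff D P = -(pairDiff D P * D) := by
  have h1 : D * (D * (P * D)) = P * D := by rw [← mul_assoc, hD, one_mul]
  have h2 : D * (P * D) * D = D * P := by rw [mul_assoc, mul_assoc, hD, mul_one]
  rw [pairDiff, mul_sub, sub_mul, h1, h2, neg_sub]

/-- Reduces compactness of `A` to that of the commutator of `D` and `P`. -/
theorem pairDiff_eq_mul_commutator {D P : F →L[ℂ] F} (hD : D * D = 1) :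
    pairDiff D P = D * (D * P - P * D) := by
  rw [pairDiff, mul_sub, ← mul_assoc D D, hD, one_mul]

theorem pairSum_mul_dirac {D P : F →L[ℂ] F} (hD : D * D = 1) :
    D * pairSum D P = pairSum D P * D := by
  have h1 : D * (D * (P * D)) = P * D := by rw [← mul_assoc, hD, one_mul]
  have h2 : D * (P * D) * D = D * P := by rw [mul_assoc, mul_assoc, hD, mul_one]
  rw [pairSum, mul_sub, sub_mul, h1, h2, mul_sub, sub_mul, mul_one, one_mul]
  abel

theorem conj_mul_conj {D P : F →L[ℂ] F} (hD : D * D = 1) (hP : P * P = P) :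
    D * (P * D) * (D * (P * D)) = D * (P * D) := by
  calc D * (P * D) * (D * (P * D)) = D * (P * (D * D) * P * D) := by simp only [mul_assoc]
    _ = D * (P * D) := by rw [hD, mul_one, hP]

theorem pairDiff_sq_add_pairSum_sq {D P : F →L[ℂ] F} (hD : D * D = 1) (hP : P * P = P) :
    pairDiff D P * pairDiff D P + pairSum D P * pairSum D P = 1 := by
  have hQ := conj_mul_conj hD hP
  rw [pairDiff, pairSum]
  set Q := D * (P * D)
  simp only [mul_sub, sub_mul, one_mul, mul_one, hP, hQ]
  abel

theorem pairDiff_mul_pairSum {D P : F →L[ℂ] F} (hD : D * D = 1) (hP : P * P = P) :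
    pairDiff D P * pairSum D P = -(pairSum D P * pairDiff D P) := by
  have hQ := conj_mul_conj hD hP
  rw [pairDiff, pairSum]
  set Q := D * (P * D)
  simp only [mul_sub, sub_mul, one_mul, mul_one, hP, hQ]
  abel

theorem pairSum_pairSum_apply {D P : F →L[ℂ] F} (hD : D * D = 1) (hP : P * P = P) (v : F) :
    pairSum D P (pairSum D P v) = v - pairDiff D P (pairDiff D P v) := by
  have := congrArg (fun S : F →L[ℂ] F => S v) (pairDiff_sq_add_pairSum_sq hD hP)
  simp only [add_apply, mul_apply_eq_comp, one_apply_eq_self] at this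
  rw [eq_sub_iff_add_eq, add_comm, this]

theorem dirac_dirac_apply {D : F →L[ℂ] F} (hD : D * D = 1) (v : F) : D (D v) = v :=
  congrArg (fun S : F →L[ℂ] F => S v) hD

theorem dirac_pairDiff_apply {D P : F →L[ℂ] F} (hD : D * D = 1) (v : F) :
    D (pairDiff D P v) = -pairDiff D P (D v) :=
  congrArg (fun S : F →L[ℂ] F => S v) (pairDiff_mul_dirac (P := P) hD)

theorem dirac_pairSum_apply {D P : F →L[ℂ] F} (hD : D * D = 1) (v : F) :
    D (pairSum D P v) = pairSum D P (D v) :=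
  congrArg (fun S : F →L[ℂ] F => S v) (pairSum_mul_dirac (P := P) hD)

theorem pairSum_pairDiff_apply {D P : F →L[ℂ] F} (hD : D * D = 1) (hP : P * P = P) (v : F) :
    pairSum D P (pairDiff D P v) = -pairDiff D P (pairSum D P v) := by
  have := congrArg (fun S : F →L[ℂ] F => S v) (pairDiff_mul_pairSum hD hP)
  simp only [mul_apply_eq_comp, neg_apply] at this
  rw [this, neg_neg]

theorem pairDiff_apply (D P : F →L[ℂ] F) (v : F) : pairDiff D P v = P v - D (P (D v)) := rfl

theorem pairSum_apply (D P : F →L[ℂ] F) (v : F) : pairSum D P v = v - P v - D (P (D v)) := rfl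

theorem finrank_eigenKer_neg_one {D P : F →L[ℂ] F} (hD : D * D = 1) :
    Module.finrank ℂ (eigenKer (pairDiff D P) 1) =
      Module.finrank ℂ (eigenKer (pairDiff D P) (-1)) := by
  have h1 : ∀ v ∈ eigenKer (pairDiff D P) 1, D.toLinearMap v ∈ eigenKer (pairDiff D P) (-1) :=
    fun v hv => mem_eigenKer.2 (by
      have h := dirac_pairDiff_apply (P := P) hD v
      rw [mem_eigenKer_one.1 hv] at h
      change pairDiff D P (D v) = (-1 : ℂ) • D v
      rw [neg_one_smul]
      exact neg_eq_iff_eq_neg.1 h.symm)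
  have h2 : ∀ v ∈ eigenKer (pairDiff D P) (-1), D.toLinearMap v ∈ eigenKer (pairDiff D P) 1 :=
    fun v hv => mem_eigenKer_one.2 (by
      have h := dirac_pairDiff_apply (P := P) hD v
      rw [mem_eigenKer.1 hv, map_smul, neg_one_smul, neg_inj] at h
      exact h.symm)
  exact LinearEquiv.finrank_eq (LinearEquiv.ofLinearMap (D.toLinearMap.restrict h1)
    (D.toLinearMap.restrict h2) (LinearMap.ext fun v => Subtype.ext (dirac_dirac_apply hD v))
    (LinearMap.ext fun v => Subtype.ext (dirac_dirac_apply hD v)))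

section Antilinear

variable {D P : F →L[ℂ] F} {X : F →L⋆[ℂ] F} {η τ : ℂ}

theorem antilinear_conj_apply (hη : η = 1 ∨ η = -1) (hXD : ∀ v, X (D v) = η • D (X v))
    {P' : F →L[ℂ] F} (hXP : ∀ v, X (P v) = P' (X v)) (v : F) :
    X (D (P (D v))) = D (P' (D (X v))) := by
  rw [hXD, hXP, hXD]
  rcases hη with rfl | rfl <;> simp

/-- `W = DBX`. Here `X` commutes with `A` and `B`, and the signs from moving `A` past `B` and past
`D` cancel. Moreover `W² = ητ B²`, as `D` commutes with `B`. -/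
theorem exists_antilinear_of_commutes (hD : D * D = 1) (hP : P * P = P) (hη : η = 1 ∨ η = -1)
    (hXD : ∀ v, X (D v) = η • D (X v)) (hXP : ∀ v, X (P v) = P (X v))
    (hXX : ∀ v, X (X v) = τ • v) (hητ : η * τ = -1) :
    ∃ W : F →L⋆[ℂ] F, (∀ v, W (pairDiff D P v) = pairDiff D P (W v)) ∧
      ∀ v, W (W v) = -(v - pairDiff D P (pairDiff D P v)) := by
  have hc := antilinear_conj_apply hη hXD hXP
  have hXA : ∀ v, X (pairDiff D P v) = pairDiff D P (X v) := fun v => by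
    rw [pairDiff_apply, map_sub, hXP, hc]; rfl
  have hXB : ∀ v, X (pairSum D P v) = pairSum D P (X v) := fun v => by
    rw [pairSum_apply, map_sub, map_sub, hXP, hc]; rfl
  refine ⟨(D * pairSum D P).comp X, fun v => ?_, fun v => ?_⟩
  · change D (pairSum D P (X (pairDiff D P v))) = pairDiff D P (D (pairSum D P (X v)))
    rw [hXA, pairSum_pairDiff_apply hD hP, map_neg, dirac_pairDiff_apply hD, neg_neg]
  · change D (pairSum D P (X (D (pairSum D P (X v))))) = _
    rw [hXD, hXB, hXX, ← pairSum_pairSum_apply hD hP]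
    simp only [map_smul, smul_smul, hητ, neg_one_smul]
    rw [dirac_pairSum_apply hD, map_neg, dirac_dirac_apply hD, map_neg]

/-- `W = BX`. Here `X` anticommutes with both `A` and `B`, so `W` commutes with `A`, and `W² = -τ
B²`; `η` drops out. -/
theorem exists_antilinear_of_anticommutes (hD : D * D = 1) (hP : P * P = P) (hη : η = 1 ∨ η = -1)
    (hXD : ∀ v, X (D v) = η • D (X v)) (hXP : ∀ v, X (P v) = (1 - P) (X v))
    (hXX : ∀ v, X (X v) = τ • v) (hτ : τ = 1) :
    ∃ W : F →L⋆[ℂ] F, (∀ v, W (pairDiff D P v) = pairDiff D P (W v)) ∧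
      ∀ v, W (W v) = -(v - pairDiff D P (pairDiff D P v)) := by
  have hc := antilinear_conj_apply hη hXD hXP
  have hXA : ∀ v, X (pairDiff D P v) = -pairDiff D P (X v) := fun v => by
    rw [pairDiff_apply, map_sub, hXP, hc, pairDiff_apply]
    simp [dirac_dirac_apply hD]
  have hXB : ∀ v, X (pairSum D P v) = -pairSum D P (X v) := fun v => by
    rw [pairSum_apply, map_sub, map_sub, hXP, hc, pairSum_apply]
    simp [dirac_dirac_apply hD]
    abel
  refine ⟨(pairSum D P).comp X, fun v => ?_, fun v => ?_⟩
  · change pairSum D P (X (pairDiff D P v)) = pairDiff D P (pairSum D P (X v))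
    rw [hXA, map_neg, pairSum_pairDiff_apply hD hP, neg_neg]
  · change pairSum D P (X (pairSum D P (X v))) = _
    rw [hXB, hXX, hτ, one_smul, map_neg, pairSum_pairSum_apply hD hP]

theorem exists_antilinear_kramers_of_commutes (hη : η = 1 ∨ η = -1)
    (hXD : ∀ v, X (D v) = η • D (X v)) (hXP : ∀ v, X (P v) = P (X v))
    (hXX : ∀ v, X (X v) = τ • v) (hτ : τ = -1) :
    ∃ W : F →L⋆[ℂ] F, (∀ v, W (pairDiff D P v) = pairDiff D P (W v)) ∧ ∀ v, W (W v) = -v := by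
  refine ⟨X, fun v => ?_, fun v => by rw [hXX, hτ, neg_one_smul]⟩
  rw [pairDiff_apply, map_sub, hXP, antilinear_conj_apply hη hXD hXP]
  rfl

theorem exists_antilinear_kramers_of_anticommutes (hD : D * D = 1) (hη : η = 1 ∨ η = -1)
    (hXD : ∀ v, X (D v) = η • D (X v)) (hXP : ∀ v, X (P v) = (1 - P) (X v))
    (hXX : ∀ v, X (X v) = τ • v) (hητ : η * τ = -1) :
    ∃ W : F →L⋆[ℂ] F, (∀ v, W (pairDiff D P v) = pairDiff D P (W v)) ∧ ∀ v, W (W v) = -v := by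
  refine ⟨D.comp X, fun v => ?_, fun v => ?_⟩
  · have hXA : X (pairDiff D P v) = -pairDiff D P (X v) := by
      rw [pairDiff_apply, map_sub, hXP, antilinear_conj_apply hη hXD hXP, pairDiff_apply]
      simp [dirac_dirac_apply hD]
    change D (X (pairDiff D P v)) = pairDiff D P (D (X v))
    rw [hXA, map_neg, dirac_pairDiff_apply hD, neg_neg]
  · change D (X (D (X v))) = -v
    rw [hXD, hXX, map_smul, map_smul, map_smul, smul_smul, hητ, neg_one_smul, dirac_dirac_apply hD]

end Antilinear

variable [CompleteSpace F]

theorem norm_dirac_apply {D : F →L[ℂ] F} (hD : D * D = 1) (hDs : IsSelfAdjoint D) (v : F) :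
    ‖D v‖ = ‖v‖ := by
  have h1 : ⟪D v, D v⟫_ℂ = ⟪v, v⟫_ℂ := by
    have h := hDs.isSymmetric v (D v)
    simpa [dirac_dirac_apply hD] using h
  have h2 := congrArg Complex.re h1
  rw [re_inner_self, re_inner_self] at h2
  exact (sq_eq_sq₀ (norm_nonneg _) (norm_nonneg _)).1 h2

theorem isSelfAdjoint_conj {D P : F →L[ℂ] F} (hDs : IsSelfAdjoint D) (hPs : IsSelfAdjoint P) :
    IsSelfAdjoint (D * (P * D)) := by
  rw [IsSelfAdjoint, star_mul, star_mul, hDs.star_eq, hPs.star_eq, mul_assoc]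

theorem isSelfAdjoint_pairDiff {D P : F →L[ℂ] F} (hDs : IsSelfAdjoint D) (hPs : IsSelfAdjoint P) :
    IsSelfAdjoint (pairDiff D P) := hPs.sub (isSelfAdjoint_conj hDs hPs)

theorem isSelfAdjoint_pairSum {D P : F →L[ℂ] F} (hDs : IsSelfAdjoint D) (hPs : IsSelfAdjoint P) :
    IsSelfAdjoint (pairSum D P) :=
  ((IsSelfAdjoint.one _).sub hPs).sub (isSelfAdjoint_conj hDs hPs)

/-- From `‖A v‖² + ‖B v‖² = ‖v‖²`. -/
theorem norm_pairDiff_apply_le {D P : F →L[ℂ] F} (hD : D * D = 1) (hDs : IsSelfAdjoint D)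
    (hP : P * P = P) (hPs : IsSelfAdjoint P) (v : F) : ‖pairDiff D P v‖ ≤ ‖v‖ := by
  have hA : ∀ u w, ⟪pairDiff D P u, w⟫_ℂ = ⟪u, pairDiff D P w⟫_ℂ :=
    fun u w => (isSelfAdjoint_pairDiff hDs hPs).isSymmetric u w
  have hB : ∀ u w, ⟪pairSum D P u, w⟫_ℂ = ⟪u, pairSum D P w⟫_ℂ :=
    fun u w => (isSelfAdjoint_pairSum hDs hPs).isSymmetric u w
  have h1 : ⟪pairSum D P v, pairSum D P v⟫_ℂ =
      ⟪v, v⟫_ℂ - ⟪pairDiff D P v, pairDiff D P v⟫_ℂ := by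
    rw [hB, pairSum_pairSum_apply hD hP, inner_sub_right, hA]
  have h2 := congrArg Complex.re h1
  rw [Complex.sub_re, re_inner_self, re_inner_self, re_inner_self] at h2
  refine le_of_sq_le_sq ?_ (norm_nonneg _)
  nlinarith [sq_nonneg ‖pairSum D P v‖]

theorem norm_pairDiff_sub_le {D P P' : F →L[ℂ] F} (hD : D * D = 1) (hDs : IsSelfAdjoint D) :
    ‖pairDiff D P' - pairDiff D P‖ ≤ 2 * ‖P' - P‖ := by
  refine ContinuousLinearMap.opNorm_le_bound _ (by positivity) fun v => ?_
  have h : (pairDiff D P' - pairDiff D P) v = (P' - P) v - D ((P' - P) (D v)) := by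
    simp only [sub_apply, pairDiff_apply, map_sub]; abel
  have h1 := (P' - P).le_opNorm v
  have h2 := (P' - P).le_opNorm (D v)
  rw [norm_dirac_apply hD hDs] at h2
  rw [h]
  refine (norm_sub_le _ _).trans ?_
  rw [norm_dirac_apply hD hDs]
  linarith

end ProjectionPair

/-! ### Application to the Fermi projection and the periodic table. -/

section FermiProjection

variable {n M : ℕ} {a : EuclideanSpace ℝ (Fin (2 * n + 1))} {H : Op (2 * n + 1) M} {E : ℝ}

theorem isSelfAdjoint_fermiProj : IsSelfAdjoint (fermiProj H E) :=
  isSelfAdjoint_starProjection _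

theorem fermiProj_mul_self : fermiProj H E * fermiProj H E = fermiProj H E :=
  Submodule.isIdempotentElem_starProjection _

theorem isSelfAdjoint_tensorOp_fermiProj :
    IsSelfAdjoint (tensorOp (n := n) (fermiProj H E) 1) :=
  isSelfAdjoint_tensorOp isSelfAdjoint_fermiProj Matrix.conjTranspose_one

theorem tensorOp_fermiProj_mul_self :
    tensorOp (n := n) (fermiProj H E) 1 * tensorOp (fermiProj H E) 1 =
      tensorOp (fermiProj H E) 1 := by
  rw [tensorOp_mul, fermiProj_mul_self, mul_one]

theorem indexKer_eq_eigenKer (s : ℂ) :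
    indexKer a H E s = eigenKer (pairDiff (dirac n M a) (tensorOp (fermiProj H E) 1)) s := rfl

theorem isCompactOperator_commutator_dirac {T : Op (2 * n + 1) M}
    (h : ∀ j, IsCompactOperator (mulOp M (unitCoord a j) (abs_unitCoord_le_one a j) * T -
      T * mulOp M (unitCoord a j) (abs_unitCoord_le_one a j))) :
    IsCompactOperator (dirac n M a * tensorOp T 1 - tensorOp T 1 * dirac n M a) := by
  have h1 : dirac n M a * tensorOp T 1 - tensorOp T 1 * dirac n M a =
      ∑ j, tensorOp (mulOp M (unitCoord a j) (abs_unitCoord_le_one a j) * T -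
        T * mulOp M (unitCoord a j) (abs_unitCoord_le_one a j)) (gamma n j) := by
    rw [dirac, Finset.sum_mul, Finset.mul_sum, ← Finset.sum_sub_distrib]
    refine Finset.sum_congr rfl fun j _ => ?_
    rw [tensorOp_mul, tensorOp_mul, mul_one, one_mul, tensorOp_sub]
  rw [h1]
  have h2 : ∀ s : Finset (Fin (2 * n + 1)), IsCompactOperator ((∑ j ∈ s,
      tensorOp (mulOp M (unitCoord a j) (abs_unitCoord_le_one a j) * T -
        T * mulOp M (unitCoord a j) (abs_unitCoord_le_one a j)) (gamma n j) : SpinOp n M)) := by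
    intro s
    induction s using Finset.induction_on with
    | empty =>
      rw [Finset.sum_empty]
      exact isCompactOperator_zero
    | insert j s hj ih =>
      rw [Finset.sum_insert hj]
      exact (isCompactOperator_tensorOp (h j) _).add ih
  exact h2 _

theorem isCompactOperator_projDiff (ha : ∀ x : Site (2 * n + 1), latticePoint x ≠ a)
    (hH : IsTightBinding H) {g : ℝ} (hg : 0 < g) (hgap : ∀ v, g * ‖v‖ ≤ ‖(E : ℂ) • v - H v‖) :
    IsCompactOperator (pairDiff (dirac n M a) (tensorOp (fermiProj H E) 1)) := by
  have h1 : ∀ j, IsCompactOperator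
      (mulOp M (unitCoord a j) (abs_unitCoord_le_one a j) * fermiProj H E -
        fermiProj H E * mulOp M (unitCoord a j) (abs_unitCoord_le_one a j)) := fun j => by
    rw [fermiProj, spectralProjBelow_eq_cfc hH.isSelfAdjoint hg hgap]
    exact isCompactOperator_commutator_cfc hH.isSelfAdjoint
      (isCompactOperator_commutator_mulOp hH.hasFiniteRange _ (unitCoord_slowly_varying ha j))
      _ (continuous_gapStep hg)
  have h2 := (isCompactOperator_commutator_dirac h1).clm_comp (dirac n M a)
  rwa [pairDiff_eq_mul_commutator (dirac_mul_self ha)]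

theorem finiteDimensional_indexKer (ha : ∀ x : Site (2 * n + 1), latticePoint x ≠ a)
    (hH : IsTightBinding H) (hE : FermiLevelAdmissible H E) {s : ℂ} (hs : s ≠ 0) :
    FiniteDimensional ℂ (indexKer a H E s) := by
  obtain ⟨g, hg, hgap⟩ := hE.exists_gap hH.isSelfAdjoint
  exact finiteDimensional_eigenKer (isCompactOperator_projDiff ha hH hg hgap) hs

theorem intIndex_eq_zero (ha : ∀ x : Site (2 * n + 1), latticePoint x ≠ a) :
    intIndex a H E = 0 := by
  rw [intIndex, indexKer_eq_eigenKer, indexKer_eq_eigenKer,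
    finrank_eigenKer_neg_one (dirac_mul_self ha), sub_self]

theorem antiunitary_fermiProj_of_commutes {U : Matrix.unitaryGroup (Fin M) ℂ}
    (hH : IsSelfAdjoint H) {g : ℝ} (hg : 0 < g) (hgap : ∀ v, g * ‖v‖ ≤ ‖(E : ℂ) • v - H v‖)
    (hU : ∀ φ, antiunitary U (H φ) = H (antiunitary U φ)) (φ : Wave (2 * n + 1) M) :
    antiunitaryCLM U (fermiProj H E φ) = fermiProj H E (antiunitaryCLM U φ) := by
  rw [fermiProj, spectralProjBelow_eq_cfc hH hg hgap]
  exact antilinear_intertwines_cfc _ hH hH hU _ (continuous_gapStep hg) φ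

theorem antiunitary_fermiProj_of_anticommutes {U : Matrix.unitaryGroup (Fin M) ℂ}
    (hH : IsSelfAdjoint H) {g : ℝ} (hg : 0 < g) (hgap : ∀ v, g * ‖v‖ ≤ ‖(E : ℂ) • v - H v‖)
    (hE : E = 0) (hU : ∀ φ, antiunitary U (H φ) = -H (antiunitary U φ))
    (φ : Wave (2 * n + 1) M) :
    antiunitaryCLM U (fermiProj H E φ) = (1 - fermiProj H E) (antiunitaryCLM U φ) := by
  have hcont := continuous_gapStep (E := E) hg
  rw [fermiProj, spectralProjBelow_eq_cfc hH hg hgap, ← cfc_gapStep_neg hH hg hgap hE]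
  exact antilinear_intertwines_cfc _ hH hH.neg hU _ hcont φ

/-- The arithmetic source of the table. With `η = (-1)^n` and `τ` the sign of `X²`, the commuting
classes need `ητ = -1` and the particle-hole classes need `τ = 1`. -/
theorem z2_sign_identities {c : SymClass} (hZ : IsZ2Entry (2 * n + 1) c) :
    match c with
    | .A => False
    | .AI => (-1 : ℂ) ^ n * (chargeSign n * 1) = -1
    | .AII => (-1 : ℂ) ^ n * (chargeSign n * -1) = -1
    | .C => chargeSign n * -1 = 1
    | .D => chargeSign n * 1 = 1 := by
  cases c <;> simp only [IsZ2Entry] at hZ ⊢ <;> rw [chargeSign_eq]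
  · rw [if_pos (by omega), Odd.neg_one_pow (by rw [Nat.odd_iff]; omega)]; norm_num
  · rw [if_neg (by omega), Odd.neg_one_pow (by rw [Nat.odd_iff]; omega)]; norm_num
  · rw [if_neg (by omega)]; norm_num
  · rw [if_pos (by omega)]; norm_num

/-- For Kramers degeneracy the commuting classes need `τ = -1` (`W = X`) and the particle-hole
classes need `ητ = -1` (`W = DX`). -/
theorem kramers_sign_identities {c : SymClass} (hK : IsKramersEntry (2 * n + 1) c) :
    match c with
    | .A => False
    | .AI => chargeSign n * 1 = -1
    | .AII => chargeSign n * -1 = -1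
    | .C => (-1 : ℂ) ^ n * (chargeSign n * -1) = -1
    | .D => (-1 : ℂ) ^ n * (chargeSign n * 1) = -1 := by
  cases c <;> simp only [IsKramersEntry] at hK ⊢ <;> rw [chargeSign_eq]
  · rw [if_neg (by omega)]; norm_num
  · rw [if_pos (by omega)]; norm_num
  · rcases hK with h | h
    · rw [if_pos (by omega), Even.neg_one_pow (by rw [Nat.even_iff]; omega)]; norm_num
    · rw [if_neg (by omega), Odd.neg_one_pow (by rw [Nat.odd_iff]; omega)]; norm_num
  · rcases hK with h | h
    · rw [if_neg (by omega), Even.neg_one_pow (by rw [Nat.even_iff]; omega)]; norm_num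
    · rw [if_pos (by omega), Odd.neg_one_pow (by rw [Nat.odd_iff]; omega)]; norm_num

theorem exists_antilinear_z2 {U : Matrix.unitaryGroup (Fin M) ℂ} {c : SymClass}
    (ha : ∀ x : Site (2 * n + 1), latticePoint x ≠ a)
    (hH : IsSelfAdjoint H) {g : ℝ} (hg : 0 < g) (hgap : ∀ v, g * ‖v‖ ≤ ‖(E : ℂ) • v - H v‖)
    (hS : HasSymmetry U E H c) (hZ : IsZ2Entry (2 * n + 1) c) :
    ∃ W : SpinWave n M →L⋆[ℂ] SpinWave n M,
      (∀ v, W (pairDiff (dirac n M a) (tensorOp (fermiProj H E) 1) v) =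
        pairDiff (dirac n M a) (tensorOp (fermiProj H E) 1) (W v)) ∧
      ∀ v, W (W v) = -(v - pairDiff (dirac n M a) (tensorOp (fermiProj H E) 1)
        (pairDiff (dirac n M a) (tensorOp (fermiProj H E) 1) v)) := by
  have hsign := z2_sign_identities hZ
  have hD := dirac_mul_self (M := M) ha
  have hP := tensorOp_fermiProj_mul_self (n := n) (H := H) (E := E)
  have hη := neg_one_pow_eq_or ℂ n
  have hXD := spinAntiunitary_dirac U a
  have hcomm := fun hU φ => spinAntiunitary_tensorOp_one U
    (antiunitary_fermiProj_of_commutes hH hg hgap hU) φ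
  have hanti := fun hE hU φ => spinAntiunitary_tensorOp_one U
    (antiunitary_fermiProj_of_anticommutes hH hg hgap hE hU) φ
  simp only [tensorOp_sub, tensorOp_one_one] at hanti
  have hodd : (∀ φ : Wave (2 * n + 1) M, antiunitary U (antiunitary U φ) = -φ) →
      ∀ φ : Wave (2 * n + 1) M, antiunitary U (antiunitary U φ) = (-1 : ℂ) • φ :=
    fun h φ => by rw [h, neg_one_smul]
  have heven : (∀ φ : Wave (2 * n + 1) M, antiunitary U (antiunitary U φ) = φ) →
      ∀ φ : Wave (2 * n + 1) M, antiunitary U (antiunitary U φ) = (1 : ℂ) • φ :=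
    fun h φ => by rw [h, one_smul]
  cases c with
  | A => exact hsign.elim
  | AI =>
    exact exists_antilinear_of_commutes hD hP hη hXD (hcomm hS.2)
      (spinAntiunitary_spinAntiunitary U (heven hS.1)) hsign
  | AII =>
    exact exists_antilinear_of_commutes hD hP hη hXD (hcomm hS.2)
      (spinAntiunitary_spinAntiunitary U (hodd hS.1)) hsign
  | C =>
    exact exists_antilinear_of_anticommutes hD hP hη hXD (hanti hS.1 hS.2.2)
      (spinAntiunitary_spinAntiunitary U (hodd hS.2.1)) hsign
  | D =>
    exact exists_antilinear_of_anticommutes hD hP hη hXD (hanti hS.1 hS.2.2)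
      (spinAntiunitary_spinAntiunitary U (heven hS.2.1)) hsign

theorem exists_antilinear_kramers {U : Matrix.unitaryGroup (Fin M) ℂ} {c : SymClass}
    (ha : ∀ x : Site (2 * n + 1), latticePoint x ≠ a)
    (hH : IsSelfAdjoint H) {g : ℝ} (hg : 0 < g) (hgap : ∀ v, g * ‖v‖ ≤ ‖(E : ℂ) • v - H v‖)
    (hS : HasSymmetry U E H c) (hK : IsKramersEntry (2 * n + 1) c) :
    ∃ W : SpinWave n M →L⋆[ℂ] SpinWave n M,
      (∀ v, W (pairDiff (dirac n M a) (tensorOp (fermiProj H E) 1) v) =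
        pairDiff (dirac n M a) (tensorOp (fermiProj H E) 1) (W v)) ∧ ∀ v, W (W v) = -v := by
  have hsign := kramers_sign_identities hK
  have hD := dirac_mul_self (M := M) ha
  have hη := neg_one_pow_eq_or ℂ n
  have hXD := spinAntiunitary_dirac U a
  have hcomm := fun hU φ => spinAntiunitary_tensorOp_one U
    (antiunitary_fermiProj_of_commutes hH hg hgap hU) φ
  have hanti := fun hE hU φ => spinAntiunitary_tensorOp_one U
    (antiunitary_fermiProj_of_anticommutes hH hg hgap hE hU) φ
  simp only [tensorOp_sub, tensorOp_one_one] at hanti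
  have hodd : (∀ φ : Wave (2 * n + 1) M, antiunitary U (antiunitary U φ) = -φ) →
      ∀ φ : Wave (2 * n + 1) M, antiunitary U (antiunitary U φ) = (-1 : ℂ) • φ :=
    fun h φ => by rw [h, neg_one_smul]
  have heven : (∀ φ : Wave (2 * n + 1) M, antiunitary U (antiunitary U φ) = φ) →
      ∀ φ : Wave (2 * n + 1) M, antiunitary U (antiunitary U φ) = (1 : ℂ) • φ :=
    fun h φ => by rw [h, one_smul]
  cases c with
  | A => exact hsign.elim
  | AI =>
    exact exists_antilinear_kramers_of_commutes hη hXD (hcomm hS.2)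
      (spinAntiunitary_spinAntiunitary U (heven hS.1)) hsign
  | AII =>
    exact exists_antilinear_kramers_of_commutes hη hXD (hcomm hS.2)
      (spinAntiunitary_spinAntiunitary U (hodd hS.1)) hsign
  | C =>
    exact exists_antilinear_kramers_of_anticommutes hD hη hXD (hanti hS.1 hS.2.2)
      (spinAntiunitary_spinAntiunitary U (hodd hS.2.1)) hsign
  | D =>
    exact exists_antilinear_kramers_of_anticommutes hD hη hXD (hanti hS.1 hS.2.2)
      (spinAntiunitary_spinAntiunitary U (heven hS.2.1)) hsign

theorem exists_norm_fermiProj_sub_lt (hH : IsSelfAdjoint H) {g : ℝ} (hg : 0 < g)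
    (hgap : ∀ v, g * ‖v‖ ≤ ‖(E : ℂ) • v - H v‖) {ε : ℝ} (hε : 0 < ε) :
    ∃ δ : ℝ, 0 < δ ∧ ∀ H' : Op (2 * n + 1) M, IsSelfAdjoint H' → ‖H' - H‖ < δ →
      (∀ v, g / 2 * ‖v‖ ≤ ‖(E : ℂ) • v - H' v‖) ∧ ‖fermiProj H' E - fermiProj H E‖ < ε := by
  have hg2 : 0 < g / 2 := by linarith
  -- A perturbation of norm below `g / 2` leaves a gap `g / 2`, so one and the same continuous step
  -- represents both projections.
  obtain ⟨δ, hδ, h⟩ := exists_norm_cfc_sub_lt (gapStep E (g / 2))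
    (continuous_gapStep hg2) H hH hε
  have hgap2 : ∀ v, g / 2 * ‖v‖ ≤ ‖(E : ℂ) • v - H v‖ := fun v =>
    (mul_le_mul_of_nonneg_right (by linarith) (norm_nonneg v)).trans (hgap v)
  refine ⟨min δ (g / 2), lt_min hδ hg2, fun H' hH' hd => ?_⟩
  have hgap' : ∀ v, g / 2 * ‖v‖ ≤ ‖(E : ℂ) • v - H' v‖ := fun v => by
    have h1 : (E : ℂ) • v - H v = ((E : ℂ) • v - H' v) + (H' - H) v := by simp
    have h2 := hgap v
    rw [h1] at h2
    have h3 := norm_add_le ((E : ℂ) • v - H' v) ((H' - H) v)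
    have h4 := (H' - H).le_of_opNorm_le (hd.trans_le (min_le_right _ _)).le v
    linarith
  refine ⟨hgap', ?_⟩
  rw [fermiProj, fermiProj, spectralProjBelow_eq_cfc hH' hg2 hgap',
    spectralProjBelow_eq_cfc hH hg2 hgap2]
  exact h H' hH' (hd.trans_le (min_le_left _ _))

theorem exists_z2Index_stable {U : Matrix.unitaryGroup (Fin M) ℂ} {c : SymClass}
    (ha : ∀ x : Site (2 * n + 1), latticePoint x ≠ a) (hH : IsTightBinding H)
    (hE : FermiLevelAdmissible H E) (hZ : IsZ2Entry (2 * n + 1) c) :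
    ∃ δ : ℝ, 0 < δ ∧ ∀ H' : Op (2 * n + 1) M, IsTightBinding H' → HasSymmetry U E H' c →
      ‖H' - H‖ < δ → FiniteDimensional ℂ (indexKer a H' E 1) ∧
        z2Index a H' E = z2Index a H E := by
  obtain ⟨g, hg, hgap⟩ := hE.exists_gap hH.isSelfAdjoint
  have hD := dirac_mul_self (M := M) ha
  have hDs := isSelfAdjoint_dirac (M := M) a
  obtain ⟨δ₁, hδ₁, h₁⟩ := exists_parity_stable
    (isSelfAdjoint_pairDiff hDs (isSelfAdjoint_tensorOp_fermiProj (H := H) (E := E)))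
    (isCompactOperator_projDiff ha hH hg hgap)
    (norm_pairDiff_apply_le hD hDs tensorOp_fermiProj_mul_self isSelfAdjoint_tensorOp_fermiProj)
  -- Half of `δ₁`, because `A` changes by at most twice the change of the projection.
  obtain ⟨δ, hδ, h⟩ := exists_norm_fermiProj_sub_lt hH.isSelfAdjoint hg hgap (half_pos hδ₁)
  refine ⟨δ, hδ, fun H' hH' hS' hd => ?_⟩
  obtain ⟨hgap', hP⟩ := h H' hH'.isSelfAdjoint hd
  obtain ⟨W, hWA, hWW⟩ := exists_antilinear_z2 ha hH'.isSelfAdjoint (half_pos hg) hgap' hS' hZ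
  refine h₁ _ (isSelfAdjoint_pairDiff hDs isSelfAdjoint_tensorOp_fermiProj)
    (norm_pairDiff_apply_le hD hDs tensorOp_fermiProj_mul_self isSelfAdjoint_tensorOp_fermiProj)
    ?_ W hWA hWW
  refine (norm_pairDiff_sub_le hD hDs).trans_lt ?_
  rw [← tensorOp_sub]
  have := norm_tensorOp_one_le (fermiProj H' E - fermiProj H E)
  linarith

theorem z2Index_eq_zero_of_isKramersEntry {U : Matrix.unitaryGroup (Fin M) ℂ} {c : SymClass}
    (ha : ∀ x : Site (2 * n + 1), latticePoint x ≠ a) (hH : IsTightBinding H)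
    (hE : FermiLevelAdmissible H E) (hS : HasSymmetry U E H c)
    (hK : IsKramersEntry (2 * n + 1) c) : z2Index a H E = 0 := by
  obtain ⟨g, hg, hgap⟩ := hE.exists_gap hH.isSelfAdjoint
  obtain ⟨W, hWA, hWW⟩ := exists_antilinear_kramers ha hH.isSelfAdjoint hg hgap hS hK
  have : FiniteDimensional ℂ (eigenKer (projDiff a H E) 1) :=
    finiteDimensional_indexKer ha hH hE one_ne_zero
  exact finrank_fixed_eq_zero_of_antilinear W hWA hWW

theorem z2Index_eq_of_path {U : Matrix.unitaryGroup (Fin M) ℂ} {c : SymClass}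
    (ha : ∀ x : Site (2 * n + 1), latticePoint x ≠ a) (hZ : IsZ2Entry (2 * n + 1) c)
    {h : ℝ → Op (2 * n + 1) M} (hc : ContinuousOn h (Set.Icc 0 1))
    (hh : ∀ s ∈ Set.Icc (0 : ℝ) 1, IsTightBinding (h s) ∧ FermiLevelAdmissible (h s) E ∧
      HasSymmetry U E (h s) c) {s : ℝ} (hs : s ∈ Set.Icc (0 : ℝ) 1) :
    z2Index a (h s) E = z2Index a (h 0) E := by
  -- With the discrete topology, local constancy is continuity, and connectedness of the interval
  -- concludes.
  let _ : TopologicalSpace (ZMod 2) := ⊥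
  have _ : DiscreteTopology (ZMod 2) := ⟨rfl⟩
  refine (isPreconnected_Icc (a := (0 : ℝ)) (b := 1)).constant
    (f := fun s => z2Index a (h s) E) (fun s hs => ?_) hs ⟨le_rfl, zero_le_one⟩
  obtain ⟨ht, hE, -⟩ := hh s hs
  obtain ⟨δ, hδ, hst⟩ := exists_z2Index_stable (U := U) ha ht hE hZ
  refine Filter.Tendsto.congr' ?_ (tendsto_const_nhds (x := z2Index a (h s) E))
  have h1 := Metric.tendsto_nhds.1 (hc s hs) δ hδ
  filter_upwards [h1, self_mem_nhdsWithin] with r hr hr'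
  obtain ⟨ht', -, hS'⟩ := hh r hr'
  exact (hst (h r) ht' hS' (by rwa [← dist_eq_norm])).2.symm

end FermiProjection

end OddTI

end

theorem theorem3 (n M : ℕ) (c : OddTI.SymClass) (U : Matrix.unitaryGroup (Fin M) ℂ) (E : ℝ)
    (a : EuclideanSpace ℝ (Fin (2 * n + 1)))
    (ha : ∀ x : OddTI.Site (2 * n + 1), OddTI.latticePoint x ≠ a)
    (H : OddTI.Op (2 * n + 1) M) (hH : OddTI.IsTightBinding H)
    (hE : OddTI.FermiLevelAdmissible H E) (hS : OddTI.HasSymmetry U E H c) :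
    -- the integer-valued index is well defined and vanishes
    (FiniteDimensional ℂ (OddTI.indexKer a H E 1) ∧
      FiniteDimensional ℂ (OddTI.indexKer a H E (-1)) ∧
      OddTI.intIndex a H E = 0) ∧
    -- at the entries marked with the two-element group, the parity is robust
    (OddTI.IsZ2Entry (2 * n + 1) c →
      -- continuity in the norm of the perturbation
      (∃ δ : ℝ, 0 < δ ∧ ∀ H' : OddTI.Op (2 * n + 1) M,
        OddTI.IsTightBinding H' → OddTI.HasSymmetry U E H' c → ‖H' - H‖ < δ →
          FiniteDimensional ℂ (OddTI.indexKer a H' E 1) ∧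
          OddTI.z2Index a H' E = OddTI.z2Index a H E) ∧
      -- invariance along continuous deformations
      (∀ h : ℝ → OddTI.Op (2 * n + 1) M, ContinuousOn h (Set.Icc 0 1) → h 0 = H →
        (∀ s ∈ Set.Icc (0 : ℝ) 1, OddTI.IsTightBinding (h s) ∧
          OddTI.FermiLevelAdmissible (h s) E ∧ OddTI.HasSymmetry U E (h s) c) →
        ∀ s ∈ Set.Icc (0 : ℝ) 1, OddTI.z2Index a (h s) E = OddTI.z2Index a H E)) ∧
    -- at the entries with a Kramers degeneracy, the parity vanishes
    (OddTI.IsKramersEntry (2 * n + 1) c → OddTI.z2Index a H E = 0) := by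
  open OddTI in
  exact ⟨⟨finiteDimensional_indexKer ha hH hE one_ne_zero,
      finiteDimensional_indexKer ha hH hE (neg_ne_zero.2 one_ne_zero), intIndex_eq_zero ha⟩,
    fun hZ => ⟨exists_z2Index_stable ha hH hE hZ, fun h hc h0 hh s hs => by
      rw [← h0]
      exact z2Index_eq_of_path ha hZ hc hh hs⟩,
    z2Index_eq_zero_of_isKramersEntry ha hH hE hS⟩
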